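/- **Setting.** For input dimension $d$, consider a shortcut network with ReLU activation $\sigma(t)=\max(t,0)$ and depth $L$: $z^0=x\in\mathbb{R}^d$ and $z^l=\sigma(W^l z^{l-1}+b^l)$ for $1\le l\le L$, where layer $l\ge 1$ has $n_l\ge 1$ neurons. Its output is $$f(x;\theta)=\frac{1}{\sqrt{M}}\sum_{\kappa=0}^{K}\mathbf{1}\,z^{l_1+\kappa\hbar}\in\mathbb{R}^{n_o},\qquad M=\sum_{\kappa=0}^K n_{l_1+\kappa\hbar},$$ where $l_1,\hbar,n_o\ge 1$, $K\ge 0$, $l_1+K\hbar\le L$, and $\mathbf 1$ denotes an all-ones matrix with $n_o$ rows. All weights and biases are i.i.d. $\mathcal N(0,v)$ with $v>0$. The NNGP$^{(d)}$ kernel is $\mathbf K(x,x')=\mathbb E_\theta\langle f(x;\theta),f(x';\theta)\rangle$, and $\mathbf K_{\mathcal D,\mathcal D}=(\mathbf K(x_i,x_j))_{i,j\le N}$. A family of probability distributions $P_d$ on $\mathbb R^d$ is *well-scaled* if each $P_d$ has a finite second moment, $\int x\,dP_d=0$ for every $d$, and $\int\|x\|_2\,dP_d=\Theta(\sqrt d)$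 and $\int\|x\|_2^2\,dP_d=\Theta(d)$ as $d\to\infty$. **Theorem.** Suppose that the distributions $\mathcal N(0,\eta^2 I_d)$, $d\ge 0$, are well-scaled, and fix the architecture ($L,l_1,\hbar,K,(n_l)_{l\ge1},n_o$), the parameter variance $v>0$ and an integer $r\ge 2$. Then there are constants $c_1,c_2,c_3,c_4>0$ and $d_0\in\mathbb N$, depending only on $\eta$, $v$, $r$ and the architecture, such that for all $d\ge d_0$, all $N\ge 1$ and all i.i.d. $x_1,\dots,x_N\sim\mathcal N(0,\eta^2 I_d)$, with probability at least $1-\delta$, $$c_1 d\le\lambda_{\min}(\mathbf K_{\mathcal D,\mathcal D})\le c_2 d,\qquad\text{where}\quad \delta = N e^{-c_3 d}+N^2 e^{-c_4\, d\, N^{-2/(r-0.5)}} .$$ That is, $\lambda_{\min}(\mathbf K_{\mathcal D,\mathcal D})=\Theta(d)$ with probability at least $1-\delta$ for some $\delta\le N e^{-\Omega(d)}+N^2e^{-\Omega(dN^{-2/(r-0.5)})}$. -/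

import Mathlib

open MeasureTheory ProbabilityTheory
open scoped NNReal

noncomputable section

namespace DepthNNGP

/-- The isotropic Gaussian law `N(0, η² I_d)` on `ℝ^d`. -/
def gaussianInput (η : ℝ) (d : ℕ) : Measure (EuclideanSpace ℝ (Fin d)) :=
  (stdGaussian (EuclideanSpace ℝ (Fin d))).map (fun x => η • x)

/-- A data distribution, given in every input dimension `d`, is well-scaled if it is centred and
its first and second absolute moments are of order `√d` and `d` as `d → ∞`. -/
structure WellScaled (P : (d : ℕ) → Measure (EuclideanSpace ℝ (Fin d))) : Prop where
  isProbabilityMeasure : ∀ d, IsProbabilityMeasure (P d)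
  memLp : ∀ d, MemLp (fun x => x) 2 (P d)
  mean : ∀ d, ∫ x, x ∂(P d) = 0
  first : Asymptotics.IsTheta Filter.atTop
    (fun d : ℕ => ∫ x, ‖x‖ ∂(P d)) (fun d : ℕ => Real.sqrt (d : ℝ))
  second : Asymptotics.IsTheta Filter.atTop
    (fun d : ℕ => ∫ x, ‖x‖ ^ 2 ∂(P d)) (fun d : ℕ => (d : ℝ))

/-- The ReLU activation. -/
def relu (t : ℝ) : ℝ := max t 0

/-- The part of a shortcut network that does not depend on the input dimension: the depth `L`, the
first aggregated layer `l₁`, the separation `ħ`, the index `K` of the last shortcut (so that the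
layers `l₁, l₁ + ħ, …, l₁ + K ħ` are aggregated), the number of neurons of every hidden layer
`l ≥ 1` (the values `width 0` and `width l` for `l > L` play no role), and the number of outputs. -/
structure ShortcutNet where
  depth : ℕ
  first : ℕ
  sep : ℕ
  last : ℕ
  width : ℕ → ℕ
  outDim : ℕ
  first_pos : 1 ≤ first
  sep_pos : 1 ≤ sep
  le_depth : first + last * sep ≤ depth
  width_pos : ∀ l, 1 ≤ width l
  outDim_pos : 1 ≤ outDim

namespace ShortcutNet

variable (A : ShortcutNet)

/-- The number of neurons of layer `l`; layer `0` is the input `x ∈ ℝ^d`. -/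
def layerWidth (d : ℕ) : ℕ → ℕ
  | 0 => d
  | l + 1 => A.width (l + 1)

/-- The parameters `θ`: for every layer `l + 1 ∈ {1, …, L}`, its weight matrix `W` and its bias
vector `b`. -/
abbrev Params (d : ℕ) : Type :=
  (l : Fin A.depth) →
    (Fin (A.layerWidth d (l + 1)) → Fin (A.layerWidth d l) → ℝ) ×
      (Fin (A.layerWidth d (l + 1)) → ℝ)

/-- The law of the parameters: all weights and all biases are i.i.d. `N(0, v)`. -/
def paramLaw (v : ℝ≥0) (d : ℕ) : Measure (A.Params d) :=
  Measure.pi fun _ => (Measure.pi fun _ => Measure.pi fun _ => gaussianReal 0 v).prod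
    (Measure.pi fun _ => gaussianReal 0 v)

variable {d : ℕ}

/-- The vector `z^l` of layer `l`: `z^0 = x` and `z^{l+1} = σ(W^{l+1} z^l + b^{l+1})` with
`σ = ReLU` applied entrywise. -/
def hidden (θ : A.Params d) (x : EuclideanSpace ℝ (Fin d)) :
    (l : ℕ) → l ≤ A.depth → Fin (A.layerWidth d l) → ℝ
  | 0, _ => fun q : Fin d => x q
  | l + 1, h => fun p =>
      relu (∑ q, (θ ⟨l, h⟩).1 p q * hidden θ x l (Nat.le_of_succ_le h) q + (θ ⟨l, h⟩).2 p)

/-- Every aggregated layer is a layer of the network. -/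
theorem shortcut_le (k : Fin (A.last + 1)) : A.first + k * A.sep ≤ A.depth :=
  (Nat.add_le_add_left (Nat.mul_le_mul_right _ (Nat.lt_succ_iff.mp k.isLt)) _).trans A.le_depth

/-- The total number of neurons in the aggregated layers. -/
def aggregatedCount (d : ℕ) : ℕ :=
  ∑ k : Fin (A.last + 1), A.layerWidth d (A.first + k * A.sep)

/-- The output `f(x; θ) = M^{-1/2} ∑_{k = 0}^{K} 𝟏 z^{l₁ + k ħ}`, where `𝟏` is the matrix of ones
with `outDim` rows. -/
def output (θ : A.Params d) (x : EuclideanSpace ℝ (Fin d)) : EuclideanSpace ℝ (Fin A.outDim) :=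
  WithLp.toLp 2 ((1 / Real.sqrt (A.aggregatedCount d : ℝ)) •
    ∑ k : Fin (A.last + 1),
      Matrix.mulVec (Matrix.of fun _ _ => (1 : ℝ))
        (A.hidden θ x (A.first + k * A.sep) (A.shortcut_le k)))

/-- The kernel `K(x, x') = E_θ ⟨f(x; θ), f(x'; θ)⟩`. -/
def kernel (v : ℝ≥0) (x x' : EuclideanSpace ℝ (Fin d)) : ℝ :=
  ∫ θ, inner ℝ (A.output θ x) (A.output θ x') ∂(A.paramLaw v d)

/-- The kernel matrix of the data points `x_1, …, x_N`. -/
def kernelMatrix (v : ℝ≥0) {N : ℕ} (x : Fin N → EuclideanSpace ℝ (Fin d)) :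
    Matrix (Fin N) (Fin N) ℝ :=
  Matrix.of fun i j => A.kernel v (x i) (x j)

end ShortcutNet

/-- `t` is the smallest eigenvalue of the real matrix `B`. -/
def IsSmallestEigenvalue {N : ℕ} (B : Matrix (Fin N) (Fin N) ℝ) (t : ℝ) : Prop :=
  IsLeast {s : ℝ | Module.End.HasEigenvalue (Matrix.toLin' B) s} t

end DepthNNGP

end

/-! Up to the factor `outDim / mass`, the kernel matrix is the Gram matrix in `L²(θ)` of the
functions `θ ↦ act θ (x i)`, where `act` sums all aggregated neurons. Its smallest eigenvalue is at
most the average diagonal entry, which is `O(‖x‖² + 1)`. The content is the lower bound, obtained by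
duality: if a test family `h i` satisfies `⟨S i, h i⟩ ≥ 1`, has bounded norms, and all cross terms
of both kinds are at most `1/(2N)`, then expanding `‖X - tT‖² ≥ 0` with `X = ∑ b i S i` and `T = ∑ b
i h i` bounds `‖X‖²` below by a multiple of `∑ b i ^ 2` (`le_gram_form`). Here `S i` is `act` at `x
i` divided by `preactScale`, which is of order `‖x i‖`.

The test functions depend on one Gaussian only, the normalized pre-activation `Y i` of the first
neuron of layer 1. The tilt `exp(τ y - τ²/2)` generates the Hermite polynomials, with coefficients
polynomial in `τ`, so an `r`-th difference in `τ` removes all Hermite orders below `r`. Tilting by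
`τ` along `Y'` acts on functions of `Y` as tilting by `τ ρ` along `Y`, with `ρ` the correlation
(`integral_mul_tilt_exchange`); hence cross terms are `O(|ρ|^r)` (`abs_testFun_le`). Given the other
parameters of layer 1 and all later ones, `act` is a function of this neuron's pre-activation alone,
so the exchange holds for networks of any depth.

The diagonal pairing needs no Hermite coefficient of ReLU or of the deep network. The difference
uses the tilts `Λ, 0, -Λ, -2Λ, …`. ReLU grows linearly under the positive tilt, so that term is at
least a multiple of `Λ`. Under nonpositive tilts the moments of `act` are bounded uniformly in `τ`,
so a large `Λ` makes the first term dominate (`exists_testFun_bounds`).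

For Gaussian data, Chernoff bounds give `‖x i‖² ≍ d` and correlations below a multiple of
`N^(-1/(r-1/2))` off an event of probability `δ`. The `r`-th power of such a correlation is
`O(1/N)`, as the duality requires. -/

noncomputable section

namespace DepthNNGP

/-! ### Gaussian pre-activations of a single neuron -/

/-- The law of a neuron's weights and bias, all i.i.d. `N(0, v)`. -/
def rowLaw (v : ℝ≥0) (ι : Type*) [Fintype ι] : Measure ((ι → ℝ) × ℝ) :=
  (Measure.pi fun _ => gaussianReal 0 v).prod (gaussianReal 0 v)

/-- The pre-activation of a neuron with input `z`. -/
def preact {ι : Type*} [Fintype ι] (z : ι → ℝ) (w : (ι → ℝ) × ℝ) : ℝ :=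
  ∑ q, w.1 q * z q + w.2

section Row

variable {ι : Type*} [Fintype ι] (v : ℝ≥0)

instance : IsProbabilityMeasure (rowLaw v ι) := by
  unfold rowLaw; infer_instance

instance isGaussian_pi_gaussianReal :
    IsGaussian (Measure.pi fun _ : ι => gaussianReal 0 v) := by
  have h := iIndepFun.hasGaussianLaw (P := Measure.pi fun _ : ι => gaussianReal 0 v)
    (X := fun i (ω : ι → ℝ) => ω i)
    (fun i => ⟨by
      have : (Measure.pi fun _ : ι => gaussianReal 0 v).map (fun ω => ω i) = gaussianReal 0 v :=
        (measurePreserving_eval (fun _ : ι => gaussianReal 0 v) i).map_eq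
      rw [this]; infer_instance⟩)
    (iIndepFun_pi (X := fun _ x => x) fun i => aemeasurable_id)
  simpa using h.isGaussian_map

instance : IsGaussian (rowLaw v ι) := by
  unfold rowLaw; infer_instance

theorem continuous_preact (z : ι → ℝ) : Continuous (preact z) := by
  unfold preact; fun_prop

theorem measurable_preact (z : ι → ℝ) : Measurable (preact z) :=
  (continuous_preact z).measurable

/-- The pre-activation as a continuous linear functional of the weights and the bias. -/
def preactCLM (z : ι → ℝ) : ((ι → ℝ) × ℝ) →L[ℝ] ℝ where
  toFun := preact z
  map_add' a b := by
    simp only [preact, Prod.fst_add, Pi.add_apply, Prod.snd_add, add_mul, Finset.sum_add_distrib]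
    ring
  map_smul' c a := by
    simp only [preact, Prod.smul_fst, Pi.smul_apply, Prod.smul_snd, smul_eq_mul, mul_add,
      Finset.mul_sum, RingHom.id_apply, mul_assoc]
  cont := continuous_preact z

theorem memLp_preact (z : ι → ℝ) : MemLp (preact z) 2 (rowLaw v ι) :=
  IsGaussian.memLp_dual _ (preactCLM z) 2 (by simp)

theorem memLp_eval_gaussian (i : ι) :
    MemLp (fun w : ι → ℝ => w i) 2 (Measure.pi fun _ : ι => gaussianReal 0 v) :=
  IsGaussian.memLp_dual _ (ContinuousLinearMap.proj i : (ι → ℝ) →L[ℝ] ℝ) 2 (by simp)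

theorem covariance_eval_gaussian [DecidableEq ι] (i j : ι) :
    cov[fun w : ι → ℝ => w i, fun w => w j; Measure.pi fun _ : ι => gaussianReal 0 v]
      = if i = j then (v : ℝ) else 0 := by
  split_ifs with h
  · subst h
    rw [covariance_self (measurable_pi_apply i).aemeasurable]
    have := (measurePreserving_eval (fun _ : ι => gaussianReal 0 v) i)
    have h2 := variance_map (μ := Measure.pi fun _ : ι => gaussianReal 0 v) (X := fun x : ℝ => x)
      (Y := Function.eval i) (by fun_prop) (measurable_pi_apply i).aemeasurable
    rw [this.map_eq, variance_fun_id_gaussianReal] at h2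
    exact h2.symm
  · exact ((iIndepFun_pi (μ := fun _ : ι => gaussianReal 0 v) (X := fun _ x => x)
      fun i => aemeasurable_id).indepFun h).covariance_eq_zero (memLp_eval_gaussian v i)
      (memLp_eval_gaussian v j)

/-- Weights and bias are independent, so their covariances add; the bias contributes the `+ 1`, as
if every input carried an extra coordinate equal to 1. -/
theorem covariance_preact (z z' : ι → ℝ) :
    cov[preact z, preact z'; rowLaw v ι] = v * (∑ q, z q * z' q + 1) := by
  classical
  set μ : Measure (ι → ℝ) := Measure.pi fun _ => gaussianReal 0 v with hμ
  have hm : ∀ y : ι → ℝ, MemLp (fun w : ι → ℝ => ∑ q, w q * y q) 2 μ := fun y =>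
    memLp_finsetSum _ fun q _ => (memLp_eval_gaussian v q).mul_const _
  have hs : MemLp (fun x : ℝ => x) 2 (gaussianReal 0 v) := memLp_id_gaussianReal' 2 (by simp)
  have h1 : ∀ y : ι → ℝ, MemLp (fun w : (ι → ℝ) × ℝ => ∑ q, w.1 q * y q) 2 (rowLaw v ι) :=
    fun y => (hm y).comp_fst _
  have h2 : MemLp (fun w : (ι → ℝ) × ℝ => w.2) 2 (rowLaw v ι) := hs.comp_snd _
  have hp : ∀ y : ι → ℝ, preact y = (fun w : (ι → ℝ) × ℝ => ∑ q, w.1 q * y q) + fun w => w.2 :=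
    fun y => rfl
  have h12 : ∀ y : ι → ℝ,
      cov[fun w : (ι → ℝ) × ℝ => ∑ q, w.1 q * y q, fun w => w.2; rowLaw v ι] = 0 :=
    fun y => covariance_fst_snd_prod (hm y) hs
  have h22 : cov[fun w : (ι → ℝ) × ℝ => w.2, fun w => w.2; rowLaw v ι] = v := by
    rw [covariance_self (by fun_prop)]
    have h2 := variance_map (μ := rowLaw v ι) (X := fun x : ℝ => x)
      (Y := Prod.snd) (by fun_prop) (by fun_prop)
    have h3 : (rowLaw v ι).map Prod.snd = gaussianReal 0 v := by
      unfold rowLaw; exact measurePreserving_snd.map_eq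
    rw [h3, variance_fun_id_gaussianReal] at h2
    exact h2.symm
  have h11 : cov[fun w : (ι → ℝ) × ℝ => ∑ q, w.1 q * z q, fun w => ∑ q, w.1 q * z' q;
      rowLaw v ι] = v * ∑ q, z q * z' q := by
    have h3 : (rowLaw v ι).map Prod.fst = μ := by
      unfold rowLaw; exact measurePreserving_fst.map_eq
    have h4 := covariance_map_fun (μ := rowLaw v ι) (Z := Prod.fst)
      (X := fun w : ι → ℝ => ∑ q, w q * z q) (Y := fun w : ι → ℝ => ∑ q, w q * z' q)
      (by rw [h3]; exact (hm z).aestronglyMeasurable)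
      (by rw [h3]; exact (hm z').aestronglyMeasurable) (by fun_prop)
    rw [← h4, h3, covariance_fun_sum_fun_sum
      (fun q => (memLp_eval_gaussian v q).mul_const _)
      (fun q => (memLp_eval_gaussian v q).mul_const _)]
    simp only [covariance_mul_const_left, covariance_mul_const_right]
    simp only [covariance_eval_gaussian, ite_mul, zero_mul, Finset.sum_ite_eq, Finset.mem_univ,
      if_true, Finset.mul_sum]
    refine Finset.sum_congr rfl fun q _ => by ring
  rw [hp, hp, covariance_add_left (h1 z) h2 ((h1 z').add h2),
    covariance_add_right (h1 z) (h1 z') h2, covariance_add_right h2 (h1 z') h2, h11, h22, h12,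
    covariance_comm, h12]
  ring

theorem integral_preact (z : ι → ℝ) : ∫ w, preact z w ∂rowLaw v ι = 0 := by
  have hs : Integrable (fun x : ℝ => x) (gaussianReal 0 v) :=
    (memLp_id_gaussianReal' 1 (by simp)).integrable le_rfl
  have hm : ∀ q, ∫ w : ι → ℝ, w q ∂(Measure.pi fun _ => gaussianReal 0 v) = 0 := fun q => by
    have := integral_comp_eval (μ := fun _ : ι => gaussianReal 0 v) (i := q) (f := fun x : ℝ => x)
      (by fun_prop)
    simpa using this
  unfold preact rowLaw
  rw [integral_add]
  · rw [integral_fun_fst (f := fun w : ι → ℝ => ∑ q, w q * z q), integral_fun_snd (f := fun x : ℝ => x),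
      integral_finsetSum _ fun q _ =>
        ((memLp_eval_gaussian v q).integrable (by norm_num)).mul_const _]
    simp [integral_mul_const, hm]
  · exact (integrable_finsetSum _ fun q _ =>
        ((memLp_eval_gaussian v q).integrable (by norm_num)).mul_const (z q)).comp_fst _
  · exact hs.comp_snd _

theorem map_preact (z : ι → ℝ) :
    (rowLaw v ι).map (preact z) = gaussianReal 0 ((v : ℝ) * (∑ q, z q ^ 2 + 1)).toNNReal := by
  have h : HasGaussianLaw (preact z) (rowLaw v ι) := ⟨isGaussian_map (preactCLM z)⟩
  rw [h.map_eq_gaussianReal, integral_preact, ← covariance_self (by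
    exact (measurable_preact z).aemeasurable), covariance_preact]
  simp [sq]

/-- A pre-activation is independent of the residual of its regression on another one. -/
theorem indepFun_preact_sub (z z' : ι → ℝ) (c : ℝ)
    (hc : c * (∑ q, z q ^ 2 + 1) = ∑ q, z q * z' q + 1) :
    IndepFun (preact z) (fun w => preact z' w - c * preact z w) (rowLaw v ι) := by
  refine HasGaussianLaw.indepFun_of_covariance_eq_zero
    ⟨isGaussian_map ((preactCLM z).prod (preactCLM z' - c • preactCLM z))⟩ ?_
  rw [covariance_fun_sub_right (memLp_preact v z) (memLp_preact v z')
    ((memLp_preact v z).const_mul c), covariance_const_mul_right, covariance_preact,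
    covariance_preact, ← hc]
  simp only [sq]; ring

end Row

/-! ### Exponential tilts and their finite differences -/

/-- The Radon-Nikodym density of `N(τ, 1)` with respect to `N(0, 1)`. -/
def tilt (τ y : ℝ) : ℝ := Real.exp (τ * y - τ ^ 2 / 2)

theorem tilt_pos (τ y : ℝ) : 0 < tilt τ y := Real.exp_pos _

theorem measurable_tilt (τ : ℝ) : Measurable (tilt τ) := by
  unfold tilt; fun_prop

/-- The `r`-th difference with step `-Λ` of `τ ↦ tilt τ` at `Λ`, dilated by `ρ`. -/
def testFun (r : ℕ) (Λ ρ y : ℝ) : ℝ :=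
  ∑ j ∈ Finset.range (r + 1), ((-1) ^ j * (r.choose j : ℝ)) * tilt (Λ * (1 - j) * ρ) y

theorem measurable_testFun (r : ℕ) (Λ ρ : ℝ) : Measurable (testFun r Λ ρ) :=
  Finset.measurable_fun_sum _ fun _ _ => (measurable_tilt _).const_mul _

/-- An `r`-th finite difference annihilates polynomials of degree below `r`; reflecting the
summation index places the nodes at `1 - j`. -/
theorem alternating_sum_choose_mul_pow_eq_zero {r n : ℕ} (h : n < r) :
    ∑ j ∈ Finset.range (r + 1), ((-1) ^ j * (r.choose j : ℝ)) * (1 - (j : ℝ)) ^ n = 0 := by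
  have h1 : (fwdDiff (1 : ℝ))^[r] (fun x : ℝ => x ^ n) (1 - r) = 0 := by
    rw [fwdDiff_iter_pow_eq_zero_of_lt h]; rfl
  rw [fwdDiff_iter_eq_sum_shift, ← Finset.sum_range_reflect] at h1
  rw [← h1]
  refine Finset.sum_congr rfl fun j hj => ?_
  have hj' : j ≤ r := Nat.lt_succ_iff.mp (Finset.mem_range.mp hj)
  have h2 : r - (r + 1 - 1 - j) = j := by omega
  have h3 : r + 1 - 1 - j = r - j := by omega
  rw [h2, h3, Nat.choose_symm hj']
  have h4 : (1 - (r : ℝ) + (r - j : ℕ) • (1 : ℝ)) = 1 - j := by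
    rw [nsmul_eq_mul, Nat.cast_sub hj']; ring
  rw [h4, zsmul_eq_mul]
  push_cast
  ring

theorem sum_abs_signed_choose (r : ℕ) :
    ∑ j ∈ Finset.range (r + 1), |((-1) ^ j * (r.choose j : ℝ))| = 2 ^ r := by
  have := Nat.sum_range_choose r
  rw [show (2 : ℝ) ^ r = ((2 ^ r : ℕ) : ℝ) by push_cast; rfl, ← this]
  push_cast
  exact Finset.sum_congr rfl fun j _ => by simp [abs_mul]

theorem hasSum_pow_div_factorial (a : ℝ) :
    HasSum (fun n : ℕ => a ^ n / (n.factorial : ℝ)) (Real.exp a) := by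
  rw [Real.exp_eq_exp_ℝ]
  exact NormedSpace.expSeries_div_hasSum_exp a

theorem hasSum_mul_of_summable_norm {f g : ℕ → ℝ} {s t : ℝ} (hf : HasSum f s) (hg : HasSum g t)
    (hf' : Summable fun n => ‖f n‖) (hg' : Summable fun n => ‖g n‖) :
    HasSum (fun p : ℕ × ℕ => f p.1 * g p.2) (s * t) :=
  hf.mul hg (summable_mul_of_summable_norm hf' hg')

theorem hasSum_exp_mul_exp (a b : ℝ) :
    HasSum (fun p : ℕ × ℕ => a ^ p.1 / (p.1.factorial : ℝ) * (b ^ p.2 / (p.2.factorial : ℝ)))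
      (Real.exp a * Real.exp b) := by
  have ha := hasSum_pow_div_factorial a
  have hb := hasSum_pow_div_factorial b
  have ha' := (Real.summable_pow_div_factorial a).norm
  have hb' := (Real.summable_pow_div_factorial b).norm
  have h := hasSum_mul_of_summable_norm ha hb ha' hb'
  exact h

/-- Expanding `exp(τ y)` and `exp(-τ²/2)` at `τ = Λ (1 - j) ρ` makes the `(i, k)` term proportional
to `((1 - j) ρ)^(i + 2k)`. The alternating sum over `j` removes all terms with `i + 2k < r`, so a
factor `|ρ|^r` comes out of what remains. -/
theorem abs_testFun_le {r : ℕ} (hr : 1 ≤ r) {Λ ρ : ℝ} (hΛ : 0 ≤ Λ) (hρ : |ρ| ≤ 1) (y : ℝ) :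
    |testFun r Λ ρ y| ≤
      |ρ| ^ r * (2 ^ r * (Real.exp (Λ * r * |y|) * Real.exp ((Λ * r) ^ 2 / 2))) := by
  set c : ℕ → ℝ := fun j => (-1) ^ j * (r.choose j : ℝ) with hc
  have hr' : (1 : ℝ) ≤ r := by exact_mod_cast hr
  have h1 : HasSum (fun p : ℕ × ℕ => ∑ j ∈ Finset.range (r + 1),
      c j * (((Λ * (1 - j) * ρ) * y) ^ p.1 / p.1.factorial *
        ((-(Λ * (1 - j) * ρ) ^ 2 / 2) ^ p.2 / p.2.factorial))) (testFun r Λ ρ y) := by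
    refine hasSum_sum fun j _ => ?_
    have := (hasSum_exp_mul_exp ((Λ * (1 - j) * ρ) * y) (-(Λ * (1 - j) * ρ) ^ 2 / 2)).mul_left (c j)
    rwa [← Real.exp_add, show (Λ * (1 - j) * ρ) * y + -(Λ * (1 - (j : ℝ)) * ρ) ^ 2 / 2
      = (Λ * (1 - j) * ρ) * y - (Λ * (1 - j) * ρ) ^ 2 / 2 by ring] at this
  have h2 := ((hasSum_exp_mul_exp (Λ * r * |y|) ((Λ * r) ^ 2 / 2)).mul_left (2 ^ r)).mul_left
    (|ρ| ^ r)
  rw [← h1.tsum_eq, ← Real.norm_eq_abs]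
  refine tsum_of_norm_bounded h2 fun p => ?_
  obtain ⟨i, k⟩ := p
  have h3 : ∀ j : ℕ, c j * (((Λ * (1 - j) * ρ) * y) ^ i / i.factorial *
        ((-(Λ * (1 - j) * ρ) ^ 2 / 2) ^ k / k.factorial)) =
      (c j * (1 - (j : ℝ)) ^ (i + 2 * k)) * (ρ ^ (i + 2 * k) * ((Λ * y) ^ i / i.factorial *
        ((-Λ ^ 2 / 2) ^ k / k.factorial))) := by
    intro j
    have e1 : ((Λ * (1 - j) * ρ) * y) ^ i = (1 - (j : ℝ)) ^ i * ρ ^ i * (Λ * y) ^ i := by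
      rw [← mul_pow, ← mul_pow]; ring
    have e2 : (-(Λ * (1 - j) * ρ) ^ 2 / 2) ^ k =
        (1 - (j : ℝ)) ^ (2 * k) * ρ ^ (2 * k) * (-Λ ^ 2 / 2) ^ k := by
      rw [pow_mul, pow_mul, ← mul_pow, ← mul_pow]; ring
    rw [e1, e2, pow_add, pow_add]; ring
  simp only [h3]
  rw [← Finset.sum_mul]
  -- Surviving terms are bounded with `|1 - j| ≤ r` and `|ρ|^(i + 2k) ≤ |ρ|^r`; the majorants sum to
  -- the exponentials of `Λ r |y|` and `(Λ r)² / 2`.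
  by_cases hlt : i + 2 * k < r
  · rw [alternating_sum_choose_mul_pow_eq_zero hlt]
    simp only [zero_mul, norm_zero]
    positivity
  · push Not at hlt
    have hsum : |∑ j ∈ Finset.range (r + 1), c j * (1 - (j : ℝ)) ^ (i + 2 * k)| ≤
        2 ^ r * (r : ℝ) ^ (i + 2 * k) := by
      refine (Finset.abs_sum_le_sum_abs _ _).trans ?_
      rw [← sum_abs_signed_choose, Finset.sum_mul]
      refine Finset.sum_le_sum fun j hj => ?_
      have hj' : (j : ℝ) ≤ r := by exact_mod_cast Nat.lt_succ_iff.mp (Finset.mem_range.mp hj)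
      rw [abs_mul, abs_pow]
      gcongr
      rw [abs_le]
      have : (0 : ℝ) ≤ j := by positivity
      constructor <;> linarith
    have hρ' : |ρ| ^ (i + 2 * k) ≤ |ρ| ^ r := pow_le_pow_of_le_one (abs_nonneg _) hρ hlt
    rw [Real.norm_eq_abs, abs_mul, abs_mul, abs_pow]
    calc _ ≤ (2 ^ r * (r : ℝ) ^ (i + 2 * k)) * (|ρ| ^ r * |(Λ * y) ^ i / i.factorial *
        ((-Λ ^ 2 / 2) ^ k / k.factorial)|) := by gcongr
      _ = _ := by
        have e1 : |(Λ * y) ^ i / i.factorial * ((-Λ ^ 2 / 2) ^ k / k.factorial)| =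
            (Λ * |y|) ^ i / i.factorial * ((Λ ^ 2 / 2) ^ k / k.factorial) := by
          simp only [abs_mul, abs_div, abs_pow, abs_neg, Nat.abs_cast, abs_of_nonneg hΛ, abs_two]
        rw [e1, pow_add, pow_mul]
        simp only [mul_pow, div_pow]
        ring

/-! ### Tilted moments of the standard Gaussian -/

theorem integrable_tilt (τ : ℝ) : Integrable (tilt τ) (gaussianReal 0 1) := by
  have := (integrable_exp_mul_gaussianReal (μ := 0) (v := 1) τ).mul_const (Real.exp (-(τ ^ 2 / 2)))
  refine this.congr (.of_forall fun y => ?_)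
  simp only [tilt, ← Real.exp_add]; congr 1

theorem integral_tilt (τ : ℝ) : ∫ y, tilt τ y ∂gaussianReal 0 1 = 1 := by
  have h := congrFun (mgf_fun_id_gaussianReal (μ := 0) (v := 1)) τ
  simp only [mgf] at h
  have : ∀ y, tilt τ y = Real.exp (τ * y) * Real.exp (-(τ ^ 2 / 2)) := fun y => by
    rw [tilt, ← Real.exp_add]; rfl
  simp_rw [this, integral_mul_const, h, ← Real.exp_add]
  simp

theorem integrable_sq_gaussian : Integrable (fun y : ℝ => y ^ 2) (gaussianReal 0 1) :=
  (memLp_id_gaussianReal' 2 (by simp)).integrable_sq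

theorem integral_sq_gaussian : ∫ y, y ^ 2 ∂gaussianReal 0 1 = 1 := by
  have h := variance_fun_id_gaussianReal (μ := 0) (v := 1)
  rw [variance_of_integral_eq_zero (by fun_prop) (by simp)] at h
  simpa using h

theorem memLp_exp_abs (L : ℝ) : MemLp (fun y : ℝ => Real.exp (L * |y|)) 2 (gaussianReal 0 1) := by
  rw [memLp_two_iff_integrable_sq (by fun_prop)]
  refine ((integrable_exp_mul_gaussianReal (μ := 0) (v := 1) (2 * L)).add
    (integrable_exp_mul_gaussianReal (μ := 0) (v := 1) (-(2 * L)))).mono' (by fun_prop)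
    (.of_forall fun y => ?_)
  rw [Real.norm_eq_abs, abs_of_nonneg (by positivity), ← Real.exp_nat_mul]
  simp only [Pi.add_apply]
  push_cast
  rcases abs_cases y with ⟨h, _⟩ | ⟨h, _⟩ <;> rw [h]
  · rw [show 2 * (L * y) = 2 * L * y by ring]
    linarith [Real.exp_pos (-(2 * L) * y)]
  · rw [show 2 * (L * -y) = -(2 * L) * y by ring]
    linarith [Real.exp_pos ((2 * L) * y)]

theorem relu_nonneg (t : ℝ) : 0 ≤ relu t := le_max_right _ _

theorem le_relu (t : ℝ) : t ≤ relu t := le_max_left _ _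

theorem relu_sq_le (t : ℝ) : relu t ^ 2 ≤ t ^ 2 := by
  unfold relu
  rcases le_total t 0 with h | h
  · rw [max_eq_right h, zero_pow two_ne_zero]; exact sq_nonneg t
  · rw [max_eq_left h]

theorem measurable_relu : Measurable relu := by
  unfold relu; fun_prop

theorem relu_mul {s : ℝ} (hs : 0 ≤ s) (t : ℝ) : relu (s * t) = s * relu t := by
  unfold relu; rw [mul_max_of_nonneg _ _ hs, mul_zero]

/-- Where ReLU does not vanish, `y ≥ 0`, and there a nonpositive tilt has density at most 1. This
makes the second moments uniform in `τ ≤ 0`. -/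
theorem relu_sq_mul_tilt_le {τ : ℝ} (hτ : τ ≤ 0) (y : ℝ) : relu y ^ 2 * tilt τ y ≤ y ^ 2 := by
  rcases le_total y 0 with h | h
  · rw [relu, max_eq_right h, zero_pow two_ne_zero, zero_mul]; positivity
  · have : tilt τ y ≤ 1 := by
      rw [tilt, Real.exp_le_one_iff]
      nlinarith [mul_nonpos_of_nonpos_of_nonneg hτ h, sq_nonneg τ]
    calc _ ≤ y ^ 2 * 1 :=
          mul_le_mul (relu_sq_le y) this (tilt_pos τ y).le (sq_nonneg y)
      _ = _ := mul_one _

theorem integrable_id_mul_tilt (τ : ℝ) :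
    Integrable (fun y => y * tilt τ y) (gaussianReal 0 1) := by
  have h1 : MemLp (fun y : ℝ => y) 2 (gaussianReal 0 1) := memLp_id_gaussianReal' 2 (by simp)
  refine h1.integrable_mul (q := 2) ?_
  rw [memLp_two_iff_integrable_sq (measurable_tilt τ).aestronglyMeasurable]
  have := (integrable_tilt (2 * τ)).mul_const (Real.exp (τ ^ 2))
  refine this.congr (.of_forall fun y => ?_)
  simp only [tilt, ← Real.exp_add, ← Real.exp_nat_mul]
  congr 1; push_cast; ring

theorem integral_id_mul_tilt (τ : ℝ) : ∫ y, y * tilt τ y ∂gaussianReal 0 1 = τ := by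
  have hint : τ ∈ interior (integrableExpSet (fun y : ℝ => y) (gaussianReal 0 1)) := by
    rw [integrableExpSet_fun_id_gaussianReal]; simp
  have h1 := deriv_mgf hint
  rw [mgf_fun_id_gaussianReal] at h1
  have h2 : HasDerivAt (fun t : ℝ => Real.exp (0 * t + (1 : ℝ≥0) * t ^ 2 / 2))
      (Real.exp (τ ^ 2 / 2) * τ) τ := by
    have : HasDerivAt (fun t : ℝ => 0 * t + (1 : ℝ≥0) * t ^ 2 / 2) τ τ := by
      have h := ((hasDerivAt_pow 2 τ).div_const 2)
      refine (h.congr_deriv (by simp)).congr_of_eventuallyEq (.of_forall fun t => by simp)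
    refine this.exp.congr_deriv (by simp)
  rw [h2.deriv] at h1
  have h3 : ∀ y, y * tilt τ y = y * Real.exp (τ * y) * Real.exp (-(τ ^ 2 / 2)) := fun y => by
    rw [tilt, mul_assoc, ← Real.exp_add]; rfl
  simp_rw [h3, integral_mul_const, ← h1]
  rw [mul_right_comm, ← Real.exp_add]; simp

theorem integrable_relu_mul_tilt (τ : ℝ) :
    Integrable (fun y => relu y * tilt τ y) (gaussianReal 0 1) := by
  refine (integrable_id_mul_tilt τ).mono
    (measurable_relu.mul (measurable_tilt τ)).aestronglyMeasurable (.of_forall fun y => ?_)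
  rw [norm_mul, norm_mul]
  gcongr
  rw [Real.norm_eq_abs, Real.norm_eq_abs]
  exact sq_le_sq.mp (relu_sq_le y)

/-- The tilted Gaussian is `N(τ, 1)`, with mean `τ`, and ReLU dominates the identity. This linear
growth in `τ` feeds the diagonal lower bound. -/
theorem le_integral_relu_mul_tilt (τ : ℝ) : τ ≤ ∫ y, relu y * tilt τ y ∂gaussianReal 0 1 := by
  refine (integral_id_mul_tilt τ).symm.le.trans ?_
  exact integral_mono (integrable_id_mul_tilt τ) (integrable_relu_mul_tilt τ) fun y =>
    mul_le_mul_of_nonneg_right (le_relu y) (tilt_pos τ y).le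

/-! ### Resampling coordinates of product measures -/

section Resampling

/-- A layer's law groups all weights and then all biases, whereas a neuron owns one row of weights
and one bias; this regrouping reconciles the two. -/
theorem measurePreserving_prodComm₂₃ {α β γ δ : Type*} [MeasurableSpace α] [MeasurableSpace β]
    [MeasurableSpace γ] [MeasurableSpace δ] (μa : Measure α) (μb : Measure β) (μc : Measure γ)
    (μd : Measure δ) [SFinite μa] [SFinite μb] [SFinite μc] [SFinite μd] :
    MeasurePreserving (fun p : (α × β) × (γ × δ) => ((p.1.1, p.2.1), (p.1.2, p.2.2)))
      ((μa.prod μb).prod (μc.prod μd)) ((μa.prod μc).prod (μb.prod μd)) := by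
  have hm : Measurable (fun p : (α × β) × (γ × δ) => ((p.1.1, p.2.1), (p.1.2, p.2.2))) := by
    fun_prop
  refine ⟨hm, Measure.ext_of_lintegral _ fun f hf => ?_⟩
  rw [lintegral_map hf hm, lintegral_prod _ (by fun_prop), lintegral_prod _ (by fun_prop),
    lintegral_prod _ (by fun_prop), lintegral_prod _ (by fun_prop)]
  refine lintegral_congr fun a => ?_
  have h1 : ∀ b, ∫⁻ q : γ × δ, f ((a, q.1), (b, q.2)) ∂(μc.prod μd)
      = ∫⁻ c, ∫⁻ d, f ((a, c), (b, d)) ∂μd ∂μc := fun b =>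
    lintegral_prod (fun q : γ × δ => f ((a, q.1), (b, q.2))) (by fun_prop)
  have h2 : ∀ c, ∫⁻ q : β × δ, f ((a, c), q) ∂(μb.prod μd)
      = ∫⁻ b, ∫⁻ d, f ((a, c), (b, d)) ∂μd ∂μb := fun c =>
    lintegral_prod (fun q : β × δ => f ((a, c), q)) (by fun_prop)
  simp only [h1, h2]
  refine lintegral_lintegral_swap ?_
  have : Measurable fun q : (β × γ) × δ => f ((a, q.1.2), (q.1.1, q.2)) := by fun_prop
  exact this.lintegral_prod_right'.aemeasurable

/-- Resampling one coordinate preserves a product of probability measures. -/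
theorem measurePreserving_update {ι : Type*} [Fintype ι] [DecidableEq ι] {X : ι → Type*}
    [∀ i, MeasurableSpace (X i)] (μ : (i : ι) → Measure (X i)) [∀ i, IsProbabilityMeasure (μ i)]
    (i : ι) :
    MeasurePreserving (fun p : (∀ i, X i) × X i => Function.update p.1 i p.2)
      ((Measure.pi μ).prod (μ i)) (Measure.pi μ) := by
  have hm : Measurable fun p : (∀ i, X i) × X i => Function.update p.1 i p.2 :=
    measurable_update'
  refine ⟨hm, (Measure.pi_eq fun s hs => ?_).symm⟩
  rw [Measure.map_apply hm (MeasurableSet.univ_pi hs)]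
  have h1 : (fun p : (∀ i, X i) × X i => Function.update p.1 i p.2) ⁻¹' Set.univ.pi s =
      (Set.univ.pi (Function.update s i Set.univ)) ×ˢ s i := by
    ext ⟨f, y⟩
    simp only [Set.mem_preimage, Set.mem_pi, Set.mem_univ, true_imp_iff, Set.mem_prod]
    constructor
    · intro h
      refine ⟨fun j => ?_, by simpa using h i⟩
      by_cases hj : j = i
      · subst hj; simp
      · simpa [hj] using h j
    · rintro ⟨h, hy⟩ j
      by_cases hj : j = i
      · subst hj; simpa using hy
      · simpa [hj] using h j
  rw [h1, Measure.prod_prod, Measure.pi_pi, ← Finset.mul_prod_erase _ _ (Finset.mem_univ i),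
    ← Finset.mul_prod_erase (Finset.univ) (fun j => μ j (s j)) (Finset.mem_univ i)]
  rw [Function.update_self, measure_univ, one_mul, mul_comm]
  congr 1
  refine Finset.prod_congr rfl fun j hj => ?_
  rw [Function.update_of_ne (Finset.ne_of_mem_erase hj)]

/-- The law of the weights and biases of a layer with `n` neurons and `m` inputs. -/
def layerLaw (v : ℝ≥0) (n m : ℕ) : Measure ((Fin n → Fin m → ℝ) × (Fin n → ℝ)) :=
  (Measure.pi fun _ => Measure.pi fun _ => gaussianReal 0 v).prod
    (Measure.pi fun _ => gaussianReal 0 v)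

instance (v : ℝ≥0) (n m : ℕ) : IsProbabilityMeasure (layerLaw v n m) := by
  unfold layerLaw; infer_instance

/-- The weights and the bias of a neuron. -/
def row {n m : ℕ} (p : Fin n) (y : (Fin n → Fin m → ℝ) × (Fin n → ℝ)) : (Fin m → ℝ) × ℝ :=
  (y.1 p, y.2 p)

theorem measurePreserving_row (v : ℝ≥0) {n m : ℕ} (p : Fin n) :
    MeasurePreserving (row p) (layerLaw v n m) (rowLaw v (Fin m)) :=
  (measurePreserving_eval (fun _ : Fin n => Measure.pi fun _ : Fin m => gaussianReal 0 v) p).prod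
    (measurePreserving_eval (fun _ : Fin n => gaussianReal 0 v) p)

/-- Replace the weights and the bias of a neuron. -/
def setRow {n m : ℕ} (p : Fin n) (y : (Fin n → Fin m → ℝ) × (Fin n → ℝ)) (w : (Fin m → ℝ) × ℝ) :
    (Fin n → Fin m → ℝ) × (Fin n → ℝ) :=
  (Function.update y.1 p w.1, Function.update y.2 p w.2)

theorem row_setRow {n m : ℕ} (p : Fin n) (y : (Fin n → Fin m → ℝ) × (Fin n → ℝ))
    (w : (Fin m → ℝ) × ℝ) : row p (setRow p y w) = w := by
  simp [row, setRow]

theorem row_setRow_of_ne {n m : ℕ} {p q : Fin n} (h : q ≠ p)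
    (y : (Fin n → Fin m → ℝ) × (Fin n → ℝ)) (w : (Fin m → ℝ) × ℝ) :
    row q (setRow p y w) = row q y := by
  simp [row, setRow, h]

theorem measurePreserving_setRow (v : ℝ≥0) {n m : ℕ} (p : Fin n) :
    MeasurePreserving (fun u => setRow p u.1 u.2)
      ((layerLaw v n m).prod (rowLaw v (Fin m))) (layerLaw v n m) :=
  ((measurePreserving_update
    (fun _ : Fin n => Measure.pi fun _ : Fin m => gaussianReal 0 v) p).prod
    (measurePreserving_update (fun _ : Fin n => gaussianReal 0 v) p)).comp
    (measurePreserving_prodComm₂₃ _ _ _ _)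

end Resampling

/-! ### Dependence of the layers on the parameters -/

namespace ShortcutNet

variable (A : ShortcutNet) {d : ℕ}

instance (v : ℝ≥0) (d : ℕ) : IsProbabilityMeasure (A.paramLaw v d) := by
  unfold paramLaw; infer_instance

theorem measurePreserving_updateLayer (v : ℝ≥0) (d : ℕ) (l : Fin A.depth) :
    MeasurePreserving
      (fun u : A.Params d × ((Fin (A.layerWidth d (l + 1)) → Fin (A.layerWidth d l) → ℝ) ×
        (Fin (A.layerWidth d (l + 1)) → ℝ)) => Function.update u.1 l u.2)
      ((A.paramLaw v d).prod (layerLaw v (A.layerWidth d (l + 1)) (A.layerWidth d l)))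
      (A.paramLaw v d) :=
  measurePreserving_update
    (fun l : Fin A.depth => layerLaw v (A.layerWidth d (l + 1)) (A.layerWidth d l)) l

theorem hidden_succ (θ : A.Params d) (x : EuclideanSpace ℝ (Fin d)) (l : ℕ) (h : l + 1 ≤ A.depth)
    (p : Fin (A.layerWidth d (l + 1))) :
    A.hidden θ x (l + 1) h p =
      relu (preact (A.hidden θ x l (Nat.le_of_succ_le h)) (row p (θ ⟨l, h⟩))) := rfl

theorem hidden_nonneg (θ : A.Params d) (x : EuclideanSpace ℝ (Fin d)) {l : ℕ} (hl : 1 ≤ l)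
    (h : l ≤ A.depth) (p : Fin (A.layerWidth d l)) : 0 ≤ A.hidden θ x l h p := by
  cases l with
  | zero => omega
  | succ l => rw [hidden_succ]; exact relu_nonneg _

theorem measurable_hidden (x : EuclideanSpace ℝ (Fin d)) :
    ∀ (l : ℕ) (h : l ≤ A.depth) (p : Fin (A.layerWidth d l)),
      Measurable fun θ : A.Params d => A.hidden θ x l h p
  | 0, _, _ => measurable_const
  | l + 1, h, p => by
    have ih := measurable_hidden x l (Nat.le_of_succ_le h)
    have hθ : Measurable fun θ : A.Params d => θ ⟨l, h⟩ := measurable_pi_apply _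
    refine measurable_relu.comp (Measurable.add (Finset.measurable_fun_sum _ fun q _ => ?_) ?_)
    · refine Measurable.mul ?_ (ih q)
      exact (measurable_pi_apply q).comp ((measurable_pi_apply p).comp hθ.fst)
    · exact (measurable_pi_apply p).comp hθ.snd

/-- The value of a layer depends only on the parameters of the layers up to it. -/
theorem hidden_congr (θ θ' : A.Params d) (x : EuclideanSpace ℝ (Fin d)) :
    ∀ (l : ℕ) (h : l ≤ A.depth), (∀ k : Fin A.depth, (k : ℕ) < l → θ k = θ' k) →
      A.hidden θ x l h = A.hidden θ' x l h
  | 0, _, _ => rfl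
  | l + 1, h, H => by
    funext p
    rw [hidden_succ, hidden_succ, hidden_congr θ θ' x l _ fun k hk => H k (by omega),
      H ⟨l, h⟩ (by simp)]

/-- Later layers depend on the parameters of the first layers only through its values. -/
theorem hidden_congr_of_first (θ θ' : A.Params d) (x x' : EuclideanSpace ℝ (Fin d))
    (hd : 1 ≤ A.depth) (h1 : A.hidden θ x 1 hd = A.hidden θ' x' 1 hd)
    (H : ∀ k : Fin A.depth, 1 ≤ (k : ℕ) → θ k = θ' k) :
    ∀ (l : ℕ) (_ : 1 ≤ l) (h : l ≤ A.depth), A.hidden θ x l h = A.hidden θ' x' l h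
  | 0, hl, _ => by omega
  | 1, _, _ => h1
  | l + 2, _, h => by
    funext p
    rw [hidden_succ, hidden_succ, hidden_congr_of_first θ θ' x x' hd h1 H (l + 1) (by omega),
      H ⟨l + 1, h⟩ (by simp)]

end ShortcutNet

/-! ### Normalized pre-activations and their ReLU moments -/

section Scale

variable {ι : Type*} [Fintype ι]

/-- The standard deviation of the pre-activation of a neuron with input `z`. -/
def preactScale (v : ℝ≥0) (z : ι → ℝ) : ℝ := Real.sqrt (v * (∑ q, z q ^ 2 + 1))

theorem preactScale_sq (v : ℝ≥0) (z : ι → ℝ) :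
    preactScale v z ^ 2 = v * (∑ q, z q ^ 2 + 1) :=
  Real.sq_sqrt (by positivity)

theorem preactScale_nonneg (v : ℝ≥0) (z : ι → ℝ) : 0 ≤ preactScale v z := Real.sqrt_nonneg _

theorem preactScale_pos {v : ℝ≥0} (hv : 0 < v) (z : ι → ℝ) : 0 < preactScale v z := by
  have : (0 : ℝ) < v := hv
  have h : 0 ≤ ∑ q, z q ^ 2 := Finset.sum_nonneg fun q _ => sq_nonneg _
  exact Real.sqrt_pos.mpr (by positivity)

/-- The normalized pre-activation. -/
def stdPreact (v : ℝ≥0) (z : ι → ℝ) (w : (ι → ℝ) × ℝ) : ℝ := preact z w / preactScale v z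

theorem measurable_stdPreact (v : ℝ≥0) (z : ι → ℝ) : Measurable (stdPreact v z) :=
  (measurable_preact z).div_const _

theorem preact_eq_mul_stdPreact {v : ℝ≥0} (hv : 0 < v) (z : ι → ℝ) (w : (ι → ℝ) × ℝ) :
    preact z w = preactScale v z * stdPreact v z w := by
  rw [stdPreact, mul_div_cancel₀ _ (preactScale_pos hv z).ne']

theorem measurePreserving_stdPreact {v : ℝ≥0} (hv : 0 < v) (z : ι → ℝ) :
    MeasurePreserving (stdPreact v z) (rowLaw v ι) (gaussianReal 0 1) := by
  refine ⟨measurable_stdPreact v z, ?_⟩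
  have h : stdPreact v z = (fun t => t / preactScale v z) ∘ preact z := rfl
  rw [h, ← Measure.map_map (by fun_prop) (measurable_preact z), map_preact,
    gaussianReal_map_div_const]
  congr 1
  · simp
  · have hs := preactScale_sq v z
    have hp : 0 < preactScale v z ^ 2 := by have := preactScale_pos hv z; positivity
    rw [← hs]
    ext
    push_cast
    rw [Real.coe_toNNReal _ hp.le]
    exact div_self hp.ne'

theorem lintegral_preact_sq (v : ℝ≥0) (z : ι → ℝ) :
    ∫⁻ w, ENNReal.ofReal (preact z w ^ 2) ∂rowLaw v ι =
      ENNReal.ofReal (v * (∑ q, z q ^ 2 + 1)) := by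
  rw [← ofReal_integral_eq_lintegral_ofReal (memLp_preact v z).integrable_sq
    (.of_forall fun w => sq_nonneg _)]
  have h := covariance_preact v z z
  rw [covariance_self (measurable_preact z).aemeasurable, variance_of_integral_eq_zero
    (measurable_preact z).aemeasurable (integral_preact v z)] at h
  rw [h]
  simp only [sq]

theorem lintegral_relu_preact_sq_le (v : ℝ≥0) (z : ι → ℝ) :
    ∫⁻ w, ENNReal.ofReal (relu (preact z w) ^ 2) ∂rowLaw v ι ≤
      ENNReal.ofReal (v * (∑ q, z q ^ 2 + 1)) := by
  rw [← lintegral_preact_sq]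
  exact lintegral_mono fun w => ENNReal.ofReal_le_ofReal (relu_sq_le _)

/-- The mean of the positive part of a standard Gaussian. -/
def reluMean : ℝ := ∫ y, relu y ∂gaussianReal 0 1

theorem integrable_relu : Integrable relu (gaussianReal 0 1) := by
  have := integrable_relu_mul_tilt 0
  simpa [tilt] using this

/-- If the mean were zero, ReLU would vanish almost everywhere and so would its tilted mean at `τ =
1`, which is at least 1. -/
theorem reluMean_pos : 0 < reluMean := by
  refine lt_of_le_of_ne (integral_nonneg relu_nonneg) fun h => ?_
  have h1 : relu =ᵐ[gaussianReal 0 1] 0 :=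
    (integral_eq_zero_iff_of_nonneg relu_nonneg integrable_relu).mp h.symm
  have h2 := le_integral_relu_mul_tilt 1
  have h3 : ∫ y, relu y * tilt 1 y ∂gaussianReal 0 1 = 0 := by
    refine integral_eq_zero_of_ae ?_
    filter_upwards [h1] with y hy
    simp [hy]
  linarith

theorem lintegral_relu_preact {v : ℝ≥0} (hv : 0 < v) (z : ι → ℝ) :
    ∫⁻ w, ENNReal.ofReal (relu (preact z w)) ∂rowLaw v ι =
      ENNReal.ofReal (preactScale v z * reluMean) := by
  simp_rw [preact_eq_mul_stdPreact hv, relu_mul (preactScale_nonneg v z)]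
  rw [(measurePreserving_stdPreact hv z).lintegral_comp
    (f := fun y => ENNReal.ofReal (preactScale v z * relu y))
    (measurable_relu.const_mul _).ennreal_ofReal,
    ← ofReal_integral_eq_lintegral_ofReal (integrable_relu.const_mul _)
      (.of_forall fun y => mul_nonneg (preactScale_nonneg v z) (relu_nonneg y)),
    integral_const_mul, reluMean]

theorem abs_le_preactScale (v : ℝ≥0) (z : ι → ℝ) (q : ι) :
    Real.sqrt v * |z q| ≤ preactScale v z := by
  rw [preactScale, ← Real.sqrt_sq_eq_abs, ← Real.sqrt_mul v.coe_nonneg]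
  refine Real.sqrt_le_sqrt (mul_le_mul_of_nonneg_left ?_ v.coe_nonneg)
  have := Finset.single_le_sum (f := fun q => z q ^ 2) (fun q _ => sq_nonneg _) (Finset.mem_univ q)
  linarith

end Scale

/-! ### Propagation of weighted moments through the layers -/

namespace ShortcutNet

variable (A : ShortcutNet) {d : ℕ}

theorem depth_pos : 0 < A.depth :=
  lt_of_lt_of_le A.first_pos (le_trans (Nat.le_add_right _ _) A.le_depth)

theorem layerWidth_of_pos (d : ℕ) {l : ℕ} (hl : 1 ≤ l) : A.layerWidth d l = A.width l := by
  cases l with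
  | zero => omega
  | succ l => rfl

theorem layerWidth_pos (d : ℕ) {l : ℕ} (hl : 1 ≤ l) : 0 < A.layerWidth d l := by
  rw [A.layerWidth_of_pos d hl]; exact A.width_pos l

/-- Integrating a function of a neuron over the parameters of its layer. -/
theorem lintegral_mul_hidden_succ (v : ℝ≥0) (x : EuclideanSpace ℝ (Fin d)) {l : ℕ}
    (h : l + 1 ≤ A.depth) (p : Fin (A.layerWidth d (l + 1))) {G : A.Params d → ENNReal}
    (hG : Measurable G) (hGl : ∀ θ y, G (Function.update θ ⟨l, h⟩ y) = G θ)
    {f : ℝ → ENNReal} (hf : Measurable f) :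
    ∫⁻ θ, G θ * f (A.hidden θ x (l + 1) h p) ∂A.paramLaw v d =
      ∫⁻ θ, G θ * ∫⁻ w, f (relu (preact (A.hidden θ x l (Nat.le_of_succ_le h)) w))
        ∂rowLaw v (Fin (A.layerWidth d l)) ∂A.paramLaw v d := by
  have hF : Measurable fun θ => G θ * f (A.hidden θ x (l + 1) h p) :=
    hG.mul (hf.comp (A.measurable_hidden x _ h p))
  have hF' := hF.comp (A.measurePreserving_updateLayer v d ⟨l, h⟩).measurable
  simp only [Function.comp_def] at hF'
  rw [← (A.measurePreserving_updateLayer v d ⟨l, h⟩).lintegral_comp hF, lintegral_prod _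
    hF'.aemeasurable]
  refine lintegral_congr fun θ => ?_
  have h1 : ∀ y, A.hidden (Function.update θ ⟨l, h⟩ y) x (l + 1) h p =
      relu (preact (A.hidden θ x l (Nat.le_of_succ_le h)) (row p y)) := fun y => by
    rw [hidden_succ, Function.update_self, A.hidden_congr _ θ x l _ fun k hk => ?_]
    exact Function.update_of_ne (fun hh => by rw [hh] at hk; exact absurd hk (lt_irrefl _)) _ _
  have h2 : Measurable fun w => f (relu (preact (A.hidden θ x l (Nat.le_of_succ_le h)) w)) :=
    hf.comp (measurable_relu.comp (measurable_preact _))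
  simp only [hGl, h1]
  have h3 := h2.comp (measurePreserving_row v p).measurable
  simp only [Function.comp_def] at h3
  rw [lintegral_const_mul _ h3,
    (measurePreserving_row v p).lintegral_comp h2]

/-- The squared norm of a layer. -/
def normSq (θ : A.Params d) (x : EuclideanSpace ℝ (Fin d)) (l : ℕ) (h : l ≤ A.depth) : ENNReal :=
  ∑ p, ENNReal.ofReal (A.hidden θ x l h p ^ 2)

theorem measurable_normSq (x : EuclideanSpace ℝ (Fin d)) (l : ℕ) (h : l ≤ A.depth) :
    Measurable fun θ : A.Params d => A.normSq θ x l h :=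
  Finset.measurable_fun_sum _ fun p _ => ((A.measurable_hidden x l h p).pow_const 2).ennreal_ofReal

theorem lintegral_mul_normSq_succ_le (v : ℝ≥0) (x : EuclideanSpace ℝ (Fin d)) {l : ℕ}
    (h : l + 1 ≤ A.depth) {G : A.Params d → ENNReal}
    (hG : Measurable G) (hGl : ∀ θ y, G (Function.update θ ⟨l, h⟩ y) = G θ) :
    ∫⁻ θ, G θ * A.normSq θ x (l + 1) h ∂A.paramLaw v d ≤
      (A.width (l + 1) * v : ℝ≥0) * (∫⁻ θ, G θ * A.normSq θ x l (Nat.le_of_succ_le h)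
        ∂A.paramLaw v d + ∫⁻ θ, G θ ∂A.paramLaw v d) := by
  have hm := A.measurable_normSq x l (Nat.le_of_succ_le h)
  have h1 : ∀ p, ∫⁻ θ, G θ * ENNReal.ofReal (A.hidden θ x (l + 1) h p ^ 2) ∂A.paramLaw v d ≤
      v * (∫⁻ θ, G θ * A.normSq θ x l (Nat.le_of_succ_le h)
        ∂A.paramLaw v d + ∫⁻ θ, G θ ∂A.paramLaw v d) := fun p => by
    rw [A.lintegral_mul_hidden_succ v x h p hG hGl
      (f := fun t => ENNReal.ofReal (t ^ 2)) (by fun_prop), ← lintegral_add_left (hG.fun_mul hm),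
      ← lintegral_const_mul _ ((hG.fun_mul hm).fun_add hG)]
    refine lintegral_mono fun θ => ?_
    calc _ ≤ G θ * ENNReal.ofReal
            (v * (∑ q, A.hidden θ x l (Nat.le_of_succ_le h) q ^ 2 + 1)) := by
          gcongr
          exact lintegral_relu_preact_sq_le v _
      _ = G θ * (v * (A.normSq θ x l (Nat.le_of_succ_le h) + 1)) := by
          rw [ENNReal.ofReal_mul v.coe_nonneg, ENNReal.ofReal_coe_nnreal,
            ENNReal.ofReal_add (Finset.sum_nonneg fun q _ => sq_nonneg _) zero_le_one,
            ENNReal.ofReal_sum_of_nonneg fun q _ => sq_nonneg _, ENNReal.ofReal_one, normSq]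
      _ = _ := by ring
  calc _ = ∑ p, ∫⁻ θ, G θ * ENNReal.ofReal (A.hidden θ x (l + 1) h p ^ 2) ∂A.paramLaw v d := by
        simp only [normSq, Finset.mul_sum]
        exact lintegral_finsetSum _ fun p _ =>
          hG.mul ((A.measurable_hidden x _ h p).pow_const 2).ennreal_ofReal
    _ ≤ ∑ _p : Fin (A.width (l + 1)), (v : ENNReal) *
          (∫⁻ θ, G θ * A.normSq θ x l (Nat.le_of_succ_le h)
        ∂A.paramLaw v d + ∫⁻ θ, G θ ∂A.paramLaw v d) := Finset.sum_le_sum fun p _ => h1 p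
    _ = _ := by
      rw [Finset.sum_const, Finset.card_univ, Fintype.card_fin, nsmul_eq_mul]
      push_cast
      ring

/-- A weight that depends on the parameters of the first layer only. -/
def IsFirstLayerWeight (G : A.Params d → ENNReal) : Prop :=
  Measurable G ∧ ∀ θ θ' : A.Params d, θ ⟨0, A.depth_pos⟩ = θ' ⟨0, A.depth_pos⟩ → G θ = G θ'

theorem IsFirstLayerWeight.update {A : ShortcutNet} {G : A.Params d → ENNReal}
    (hG : A.IsFirstLayerWeight G) {l : ℕ} (hl : 1 ≤ l) (h : l < A.depth) (θ y) :
    G (Function.update θ ⟨l, h⟩ y) = G θ :=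
  hG.2 _ _ (Function.update_of_ne (fun hh => by
    rw [Fin.mk.injEq] at hh; omega) _ _)

/-- Each layer past the first has fresh Gaussian rows independent of the weight, so it multiplies
the second moment plus one by at most a constant. Recursing from layer 1 keeps `C` free of `d`,
since the input dimension enters only there, and of `G`, hence later of `τ`. -/
theorem exists_lintegral_mul_normSq_le (v : ℝ≥0) {l : ℕ} (hl : 1 ≤ l) :
    ∃ C : ℝ≥0, ∀ (h : l ≤ A.depth) (d : ℕ) (x : EuclideanSpace ℝ (Fin d))
      (G : A.Params d → ENNReal), A.IsFirstLayerWeight G →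
      ∫⁻ θ, G θ * A.normSq θ x l h ∂A.paramLaw v d ≤
        C * (∫⁻ θ, G θ * A.normSq θ x 1 A.depth_pos ∂A.paramLaw v d +
          ∫⁻ θ, G θ ∂A.paramLaw v d) := by
  induction l, hl using Nat.le_induction with
  | base => exact ⟨1, fun h d x G hG => by simp⟩
  | succ l hl ih =>
    obtain ⟨C, hC⟩ := ih
    refine ⟨A.width (l + 1) * v * (C + 1), fun h d x G hG => ?_⟩
    refine (A.lintegral_mul_normSq_succ_le v x h hG.1 (hG.update hl h)).trans ?_
    push_cast
    rw [mul_assoc (_ * _)]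
    refine mul_le_mul_right ?_ _
    rw [add_mul, one_mul]
    exact add_le_add (hC _ d x G hG) le_add_self

/-- Integrating a neuron's fresh row gives `reluMean` times its standard deviation, which is at
least `√v` times any single neuron of the previous layer. Following neuron 0 from layer to layer
loses only a constant factor. -/
theorem exists_le_lintegral_mul_hidden {v : ℝ≥0} (hv : 0 < v) {l : ℕ} (hl : 1 ≤ l) :
    ∃ c : ℝ≥0, 0 < c ∧ ∀ (h : l ≤ A.depth) (d : ℕ) (x : EuclideanSpace ℝ (Fin d))
      (G : A.Params d → ENNReal), A.IsFirstLayerWeight G →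
      c * ∫⁻ θ, G θ * ENNReal.ofReal (A.hidden θ x 1 A.depth_pos ⟨0, A.layerWidth_pos d le_rfl⟩)
        ∂A.paramLaw v d ≤
        ∫⁻ θ, G θ * ENNReal.ofReal (A.hidden θ x l h ⟨0, A.layerWidth_pos d hl⟩)
          ∂A.paramLaw v d := by
  induction l, hl using Nat.le_induction with
  | base => exact ⟨1, one_pos, fun h d x G hG => by simp⟩
  | succ l hl ih =>
    obtain ⟨c, hc, hC⟩ := ih
    set k : ℝ≥0 := ⟨Real.sqrt v * reluMean, mul_nonneg (Real.sqrt_nonneg _) reluMean_pos.le⟩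
      with hk
    have hv' : (0 : ℝ) < v := hv
    refine ⟨k * c, mul_pos (mul_pos (Real.sqrt_pos.mpr hv') reluMean_pos) hc,
      fun h d x G hG => ?_⟩
    rw [A.lintegral_mul_hidden_succ v x h _ hG.1 (hG.update hl h) (f := ENNReal.ofReal)
      ENNReal.measurable_ofReal]
    push_cast
    rw [mul_assoc]
    refine (mul_le_mul_right (hC (Nat.le_of_succ_le h) d x G hG) _).trans ?_
    rw [← lintegral_const_mul _ (hG.1.fun_mul (A.measurable_hidden x l _ _).ennreal_ofReal)]
    refine lintegral_mono fun θ => ?_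
    rw [lintegral_relu_preact hv, mul_left_comm, ← ENNReal.ofReal_coe_nnreal,
      ← ENNReal.ofReal_mul k.coe_nonneg]
    refine mul_le_mul_right (ENNReal.ofReal_le_ofReal ?_) _
    have := abs_le_preactScale v (A.hidden θ x l (Nat.le_of_succ_le h))
      ⟨0, A.layerWidth_pos d hl⟩
    rw [abs_of_nonneg (A.hidden_nonneg θ x hl _ _)] at this
    calc _ = (Real.sqrt v * A.hidden θ x l (Nat.le_of_succ_le h) ⟨0, A.layerWidth_pos d hl⟩)
          * reluMean := by
          change Real.sqrt v * reluMean * _ = _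
          ring
      _ ≤ _ := mul_le_mul_of_nonneg_right this reluMean_pos.le

end ShortcutNet

/-! ### Exchanging tilts between two correlated pre-activations -/

section Exchange

variable {ι : Type*} [Fintype ι]

/-- The correlation of the pre-activations of a neuron at two inputs. -/
def preactCorr (v : ℝ≥0) (z z' : ι → ℝ) : ℝ :=
  v * (∑ q, z q * z' q + 1) / (preactScale v z * preactScale v z')

theorem preactCorr_self {v : ℝ≥0} (hv : 0 < v) (z : ι → ℝ) : preactCorr v z z = 1 := by
  have h := preactScale_sq v z
  have hp := preactScale_pos hv z
  rw [preactCorr, ← sq, h]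
  simp only [← sq]
  exact div_self (by rw [← h]; positivity)

theorem abs_preactCorr_le_one {v : ℝ≥0} (hv : 0 < v) (z z' : ι → ℝ) :
    |preactCorr v z z'| ≤ 1 := by
  have hp := preactScale_pos hv z
  have hp' := preactScale_pos hv z'
  rw [preactCorr, abs_div, abs_of_pos (mul_pos hp hp'), div_le_one (mul_pos hp hp'),
    ← sq_le_sq₀ (abs_nonneg _) (mul_pos hp hp').le, sq_abs, mul_pow, mul_pow, preactScale_sq,
    preactScale_sq]
  -- Cauchy–Schwarz after adjoining a coordinate equal to 1, the input seen by the bias.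
  have h : (∑ q, z q * z' q + 1) ^ 2 ≤ (∑ q, z q ^ 2 + 1) * (∑ q, z' q ^ 2 + 1) := by
    have := Finset.sum_mul_sq_le_sq_mul_sq (Finset.univ : Finset (Option ι))
      (fun o => o.elim 1 z) (fun o => o.elim 1 z')
    simp only [Fintype.sum_option, Option.elim_none, Option.elim_some] at this
    linarith
  have hv' : (0 : ℝ) ≤ v := v.coe_nonneg
  nlinarith [mul_le_mul_of_nonneg_left h (sq_nonneg (v : ℝ))]

/-- Tilting along a pre-activation acts on functions of another one through the correlation. -/
theorem integral_mul_tilt_exchange {v : ℝ≥0} (hv : 0 < v) (z z' : ι → ℝ) (τ : ℝ) {Φ : ℝ → ℝ}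
    (hΦ : Measurable Φ) :
    ∫ w, Φ (preact z w) * tilt τ (stdPreact v z' w) ∂rowLaw v ι =
      ∫ w, Φ (preact z w) * tilt (τ * preactCorr v z z') (stdPreact v z w) ∂rowLaw v ι := by
  set s := preactScale v z with hs
  set s' := preactScale v z' with hs'
  set ρ := preactCorr v z z' with hρ
  have hsp : 0 < s := preactScale_pos hv z
  have hsp' : 0 < s' := preactScale_pos hv z'
  have hv' : (0 : ℝ) < v := hv
  -- The regression coefficient of the second pre-activation on the first; the residual `R` is then
  -- independent of `preact z`.
  set c := ρ * s' / s with hc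
  have hc1 : c * (∑ q, z q ^ 2 + 1) = ∑ q, z q * z' q + 1 := by
    have h1 : ∑ q, z q ^ 2 + 1 = s ^ 2 / v := by
      rw [hs, preactScale_sq]; field_simp
    rw [h1, hc, hρ, preactCorr, ← hs, ← hs']
    field_simp
  have hind := indepFun_preact_sub v z z' c hc1
  set R : ((ι → ℝ) × ℝ) → ℝ := fun w => preact z' w - c * preact z w with hR
  have hRm : Measurable R := (measurable_preact z').sub ((measurable_preact z).const_mul c)
  -- After substituting the regression, the tilt splits into a tilt by `τ ρ` along `z` times a
  -- function of `R`. The factor from `R` does not depend on `Ψ`.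
  have key : ∀ Ψ : ℝ → ℝ, Measurable Ψ →
      ∫ w, Ψ (preact z w) * tilt τ (stdPreact v z' w) ∂rowLaw v ι =
      (∫ w, Ψ (preact z w) * tilt (τ * ρ) (stdPreact v z w) ∂rowLaw v ι) *
        ∫ w, Real.exp (τ / s' * R w + (τ * ρ) ^ 2 / 2 - τ ^ 2 / 2) ∂rowLaw v ι := by
    intro Ψ hΨ
    have h1 : IndepFun (fun w => Ψ (preact z w) * tilt (τ * ρ) (preact z w / s))
        (fun w => Real.exp (τ / s' * R w + (τ * ρ) ^ 2 / 2 - τ ^ 2 / 2)) (rowLaw v ι) :=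
      hind.comp (φ := fun t => Ψ t * tilt (τ * ρ) (t / s))
        (ψ := fun t => Real.exp (τ / s' * t + (τ * ρ) ^ 2 / 2 - τ ^ 2 / 2))
        (hΨ.mul ((measurable_tilt _).comp (by fun_prop))) (by fun_prop)
    have h2 := h1.integral_fun_mul_eq_mul_integral
      ((hΨ.comp (measurable_preact z)).mul ((measurable_tilt _).comp
        ((measurable_preact z).div_const s))).aestronglyMeasurable
      (by fun_prop)
    refine Eq.trans (integral_congr_ae (.of_forall fun w => ?_)) h2
    simp only [stdPreact, tilt]
    rw [mul_assoc, ← Real.exp_add]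
    congr 2
    simp only [hR, ← hs', hc]
    field_simp
    ring
  -- With `Ψ = 1` both tilts have mean 1, which forces the residual factor to be 1 without computing
  -- it.
  have hone := key (fun _ => 1) measurable_const
  simp only [one_mul] at hone
  have htilt : ∀ (y : ι → ℝ) (t : ℝ), ∫ w, tilt t (stdPreact v y w) ∂rowLaw v ι = 1 := by
    intro y t
    rw [← integral_tilt t, ← (measurePreserving_stdPreact hv y).map_eq, integral_map
      (measurable_stdPreact v y).aemeasurable (measurable_tilt t).aestronglyMeasurable]
  rw [htilt, htilt, one_mul] at hone
  rw [key Φ hΦ, ← hone, mul_one]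

theorem memLp_testFun (r : ℕ) (hr : 1 ≤ r) {Λ ρ : ℝ} (hΛ : 0 ≤ Λ) (hρ : |ρ| ≤ 1) :
    MemLp (testFun r Λ ρ) 2 (gaussianReal 0 1) := by
  refine ((memLp_exp_abs (Λ * r)).const_mul
    (2 ^ r * Real.exp ((Λ * r) ^ 2 / 2))).mono' (measurable_testFun r Λ ρ).aestronglyMeasurable
    (.of_forall fun y => ?_)
  rw [Real.norm_eq_abs]
  refine (abs_testFun_le hr hΛ hρ y).trans ?_
  have h1 : |ρ| ^ r ≤ 1 := pow_le_one₀ (abs_nonneg _) hρ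
  calc _ ≤ 1 * (2 ^ r * (Real.exp (Λ * r * |y|) * Real.exp ((Λ * r) ^ 2 / 2))) := by gcongr
    _ = _ := by ring

theorem memLp_tilt (τ : ℝ) : MemLp (tilt τ) 2 (gaussianReal 0 1) := by
  rw [memLp_two_iff_integrable_sq (measurable_tilt τ).aestronglyMeasurable]
  have := (integrable_tilt (2 * τ)).mul_const (Real.exp (τ ^ 2))
  refine this.congr (.of_forall fun y => ?_)
  simp only [tilt, ← Real.exp_add, ← Real.exp_nat_mul]
  congr 1; push_cast; ring

/-- The growth of the test functions, uniformly in the dilation. -/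
def testEnvelope (r : ℕ) (Λ y : ℝ) : ℝ :=
  2 ^ r * (Real.exp (Λ * r * |y|) * Real.exp ((Λ * r) ^ 2 / 2))

theorem testEnvelope_nonneg (r : ℕ) (Λ y : ℝ) : 0 ≤ testEnvelope r Λ y := by
  unfold testEnvelope; positivity

theorem memLp_testEnvelope (r : ℕ) (Λ : ℝ) :
    MemLp (testEnvelope r Λ) 2 (gaussianReal 0 1) := by
  refine MemLp.congr_norm ((memLp_exp_abs (Λ * r)).const_mul
    (2 ^ r * Real.exp ((Λ * r) ^ 2 / 2))) ?_ (.of_forall fun y => ?_)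
  · unfold testEnvelope
    fun_prop
  · congr 1; unfold testEnvelope; ring

/-- Linear combination of the exchange identities at `τ = Λ (1 - j)`: replacing each `τ` by `τ ρ` is
exactly the dilation by `ρ`. -/
theorem integral_mul_testFun_exchange {Ω : Type*} [MeasurableSpace Ω] {μ : Measure Ω}
    {F Y Y' : Ω → ℝ} {r : ℕ} {Λ ρ : ℝ} (hi' : ∀ τ, Integrable (fun ω => F ω * tilt τ (Y' ω)) μ)
    (hi : ∀ τ, Integrable (fun ω => F ω * tilt τ (Y ω)) μ)
    (h : ∀ τ, ∫ ω, F ω * tilt τ (Y' ω) ∂μ = ∫ ω, F ω * tilt (τ * ρ) (Y ω) ∂μ) :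
    ∫ ω, F ω * testFun r Λ 1 (Y' ω) ∂μ = ∫ ω, F ω * testFun r Λ ρ (Y ω) ∂μ := by
  have e : ∀ ρ' a y, a * testFun r Λ ρ' y =
      ∑ j ∈ Finset.range (r + 1), ((-1) ^ j * (r.choose j : ℝ)) *
        (a * tilt (Λ * (1 - j) * ρ') y) := by
    intro ρ' a y
    rw [testFun, Finset.mul_sum]
    exact Finset.sum_congr rfl fun j _ => by ring
  simp only [e]
  rw [integral_finsetSum _ fun j _ => (hi' _).const_mul _,
    integral_finsetSum _ fun j _ => (hi _).const_mul _]
  refine Finset.sum_congr rfl fun j _ => ?_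
  rw [integral_const_mul, integral_const_mul, h, mul_one]

/-- The Gram matrix of the test functions has off-diagonal decay of order `r`. -/
theorem abs_integral_testFun_mul_testFun_le {v : ℝ≥0} (hv : 0 < v) {r : ℕ} (hr : 1 ≤ r) {Λ : ℝ}
    (hΛ : 0 ≤ Λ) (z z' : ι → ℝ) :
    |∫ w, testFun r Λ 1 (stdPreact v z w) * testFun r Λ 1 (stdPreact v z' w) ∂rowLaw v ι| ≤
      |preactCorr v z z'| ^ r * ∫ y, testEnvelope r Λ y ^ 2 ∂gaussianReal 0 1 := by
  set ρ := preactCorr v z z' with hρ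
  have hρ1 : |ρ| ≤ 1 := abs_preactCorr_le_one hv z z'
  have hmp := measurePreserving_stdPreact hv z
  have hmp' := measurePreserving_stdPreact hv z'
  have ht := (memLp_testFun r hr hΛ (ρ := 1) (by simp)).comp_measurePreserving hmp
  have hi : ∀ τ, Integrable (fun w => testFun r Λ 1 (stdPreact v z w) *
      tilt τ (stdPreact v z' w)) (rowLaw v ι) := fun τ =>
    ht.integrable_mul ((memLp_tilt τ).comp_measurePreserving hmp')
  have hi' : ∀ τ, Integrable (fun w => testFun r Λ 1 (stdPreact v z w) *
      tilt τ (stdPreact v z w)) (rowLaw v ι) := fun τ =>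
    ht.integrable_mul ((memLp_tilt τ).comp_measurePreserving hmp)
  have h1 := integral_mul_testFun_exchange (r := r) (Λ := Λ) (ρ := ρ) hi hi' fun τ =>
    integral_mul_tilt_exchange hv z z' τ (Φ := fun t => testFun r Λ 1 (t / preactScale v z))
      ((measurable_testFun r Λ 1).comp (by fun_prop))
  refine (congrArg abs h1).le.trans ?_
  rw [← integral_const_mul]
  have h2 : ∫ w, testFun r Λ 1 (stdPreact v z w) * testFun r Λ ρ (stdPreact v z w) ∂rowLaw v ι =
      ∫ y, testFun r Λ 1 y * testFun r Λ ρ y ∂gaussianReal 0 1 := by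
    rw [← hmp.map_eq, integral_map hmp.measurable.aemeasurable
      ((measurable_testFun r Λ 1).fun_mul (measurable_testFun r Λ ρ)).aestronglyMeasurable]
  rw [h2, ← Real.norm_eq_abs]
  refine norm_integral_le_of_norm_le ((memLp_testEnvelope r Λ).integrable_sq.const_mul _)
    (.of_forall fun y => ?_)
  rw [Real.norm_eq_abs, abs_mul]
  have e1 : |testFun r Λ 1 y| ≤ testEnvelope r Λ y := by
    simpa [testEnvelope] using abs_testFun_le hr hΛ (ρ := 1) (by simp) y
  have e2 : |testFun r Λ ρ y| ≤ |ρ| ^ r * testEnvelope r Λ y := abs_testFun_le hr hΛ hρ1 y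
  calc _ ≤ testEnvelope r Λ y * (|ρ| ^ r * testEnvelope r Λ y) :=
        mul_le_mul e1 e2 (abs_nonneg _) (testEnvelope_nonneg r Λ y)
    _ = _ := by ring

end Exchange

/-! ### Lower bounds on Gram forms by duality -/

section Gram

variable {Ω : Type*} [MeasurableSpace Ω] {μ : Measure Ω}

theorem abs_sum_offDiag_le {N : ℕ} (b : Fin N → ℝ) (E : Fin N → Fin N → ℝ) {e : ℝ} (he : 0 ≤ e)
    (hE : ∀ i j, |E i j| ≤ e) : |∑ i, ∑ j, b i * b j * E i j| ≤ N * e * ∑ i, b i ^ 2 := by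
  have h1 : |∑ i, ∑ j, b i * b j * E i j| ≤ ∑ i, ∑ j, |b i| * |b j| * e := by
    refine (Finset.abs_sum_le_sum_abs _ _).trans (Finset.sum_le_sum fun i _ => ?_)
    refine (Finset.abs_sum_le_sum_abs _ _).trans (Finset.sum_le_sum fun j _ => ?_)
    rw [abs_mul, abs_mul]
    gcongr
    exact hE i j
  have h2 : ∑ i, ∑ j, |b i| * |b j| * e = (∑ i, |b i|) ^ 2 * e := by
    rw [sq, Finset.sum_mul_sum, Finset.sum_mul]
    exact Finset.sum_congr rfl fun i _ => by rw [Finset.sum_mul]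
  have h3 : (∑ i, |b i|) ^ 2 ≤ N * ∑ i, b i ^ 2 := by
    have := sq_sum_le_card_mul_sum_sq (s := (Finset.univ : Finset (Fin N))) (f := fun i => |b i|)
    simpa [sq_abs] using this
  rw [h2] at h1
  calc _ ≤ _ := h1
    _ ≤ (N * ∑ i, b i ^ 2) * e := by gcongr
    _ = _ := by ring

/-- A lower bound on the Gram form of a family that is nearly biorthogonal to a test family. -/
theorem le_gram_form {N : ℕ} {S h : Fin N → Ω → ℝ} (hS : ∀ i, MemLp (S i) 2 μ)
    (hh : ∀ i, MemLp (h i) 2 μ) {B e : ℝ} (hB : 1 ≤ B) (he : 0 ≤ e)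
    (hdiag : ∀ i, 1 ≤ ∫ ω, S i ω * h i ω ∂μ)
    (hoff : ∀ i j, i ≠ j → |∫ ω, S i ω * h j ω ∂μ| ≤ e)
    (hdiag' : ∀ i, |∫ ω, h i ω * h i ω ∂μ| ≤ B)
    (hoff' : ∀ i j, i ≠ j → |∫ ω, h i ω * h j ω ∂μ| ≤ e) (hNe : N * e ≤ 1 / 2) (b : Fin N → ℝ) :
    (∑ i, b i ^ 2) / (8 * B) ≤ ∫ ω, (∑ i, b i * S i ω) ^ 2 ∂μ := by
  classical
  set X : Ω → ℝ := fun ω => ∑ i, b i * S i ω with hX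
  set T : Ω → ℝ := fun ω => ∑ i, b i * h i ω with hT
  have hXm : MemLp X 2 μ := memLp_finsetSum _ fun i _ => (hS i).const_mul _
  have hTm : MemLp T 2 μ := memLp_finsetSum _ fun i _ => (hh i).const_mul _
  have hb : 0 ≤ ∑ i, b i ^ 2 := Finset.sum_nonneg fun i _ => sq_nonneg _
  have expand : ∀ F : Fin N → Ω → ℝ, (∀ i, MemLp (F i) 2 μ) →
      ∫ ω, (∑ i, b i * F i ω) * T ω ∂μ = ∑ i, ∑ j, b i * b j * ∫ ω, F i ω * h j ω ∂μ := by
    intro F hF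
    have hi : ∀ i j, Integrable (fun ω => F i ω * h j ω) μ := fun i j =>
      (hF i).integrable_mul (hh j)
    have e1 : ∀ ω, (∑ i, b i * F i ω) * T ω = ∑ i, ∑ j, b i * b j * (F i ω * h j ω) := by
      intro ω
      rw [hT, Finset.sum_mul_sum]
      exact Finset.sum_congr rfl fun i _ => Finset.sum_congr rfl fun j _ => by ring
    simp only [e1]
    rw [integral_finsetSum _ fun i _ => integrable_finsetSum _ fun j _ => (hi i j).const_mul _]
    refine Finset.sum_congr rfl fun i _ => ?_
    rw [integral_finsetSum _ fun j _ => (hi i j).const_mul _]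
    exact Finset.sum_congr rfl fun j _ => integral_const_mul _ _
  have split : ∀ E : Fin N → Fin N → ℝ, ∑ i, ∑ j, b i * b j * E i j =
      ∑ i, b i ^ 2 * E i i + ∑ i, ∑ j, b i * b j * (if i = j then 0 else E i j) := by
    intro E
    rw [← Finset.sum_add_distrib]
    refine Finset.sum_congr rfl fun i _ => ?_
    rw [← Finset.add_sum_erase _ _ (Finset.mem_univ i),
      ← Finset.add_sum_erase _ (fun j => b i * b j * (if i = j then 0 else E i j))
        (Finset.mem_univ i)]
    simp only [if_true, mul_zero, zero_add]
    congr 1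
    · ring
    · refine Finset.sum_congr rfl fun j hj => ?_
      rw [if_neg (Finset.ne_of_mem_erase hj).symm]
  -- The diagonal gives at least `∑ b i ^ 2`, and the off-diagonal part costs at most `N * e ≤ 1/2`
  -- of it.
  have hXT : (∑ i, b i ^ 2) / 2 ≤ ∫ ω, X ω * T ω ∂μ := by
    rw [hX, expand S hS, split]
    have h1 := abs_sum_offDiag_le b (fun i j => if i = j then 0 else ∫ ω, S i ω * h j ω ∂μ) he
      fun i j => by
        split_ifs with hij
        · simpa using he
        · exact hoff i j hij
    have h2 : ∑ i, b i ^ 2 ≤ ∑ i, b i ^ 2 * ∫ ω, S i ω * h i ω ∂μ :=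
      Finset.sum_le_sum fun i _ => le_mul_of_one_le_right (sq_nonneg _) (hdiag i)
    have h3 := (abs_le.mp h1).1
    nlinarith [mul_le_mul_of_nonneg_right hNe hb]
  have hTT : ∫ ω, T ω * T ω ∂μ ≤ 2 * B * ∑ i, b i ^ 2 := by
    conv_lhs => rw [hT]
    rw [expand h hh, split]
    have h1 := abs_sum_offDiag_le b (fun i j => if i = j then 0 else ∫ ω, h i ω * h j ω ∂μ) he
      fun i j => by
        split_ifs with hij
        · simpa using he
        · exact hoff' i j hij
    have h2 : ∑ i, b i ^ 2 * ∫ ω, h i ω * h i ω ∂μ ≤ ∑ i, b i ^ 2 * B :=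
      Finset.sum_le_sum fun i _ => mul_le_mul_of_nonneg_left
        ((le_abs_self _).trans (hdiag' i)) (sq_nonneg _)
    rw [← Finset.sum_mul] at h2
    have h3 := (abs_le.mp h1).2
    nlinarith [mul_le_mul_of_nonneg_right hNe hb, mul_le_mul_of_nonneg_right hB hb]
  -- The maximizer of `2t · (1/2) - t² · 2B`, with maximum `1 / (8B)`.
  set t : ℝ := 1 / (4 * B) with ht
  have htp : 0 < t := by positivity
  have hpos : 0 ≤ ∫ ω, (X ω - t * T ω) ^ 2 ∂μ := integral_nonneg fun ω => sq_nonneg _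
  have hexp : ∫ ω, (X ω - t * T ω) ^ 2 ∂μ =
      ∫ ω, X ω ^ 2 ∂μ - 2 * t * ∫ ω, X ω * T ω ∂μ + t ^ 2 * ∫ ω, T ω * T ω ∂μ := by
    have e1 : ∀ ω, (X ω - t * T ω) ^ 2 = X ω ^ 2 - 2 * t * (X ω * T ω) + t ^ 2 * (T ω * T ω) :=
      fun ω => by ring
    simp only [e1]
    have i1 := hXm.integrable_sq
    have i2 : Integrable (fun ω => 2 * t * (X ω * T ω)) μ := (hXm.integrable_mul hTm).const_mul _
    have i12 : Integrable (fun ω => X ω ^ 2 - 2 * t * (X ω * T ω)) μ := i1.sub i2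
    have i3 : Integrable (fun ω => t ^ 2 * (T ω * T ω)) μ := (hTm.integrable_mul hTm).const_mul _
    rw [integral_add i12 i3, integral_sub i1 i2, integral_const_mul, integral_const_mul]
  rw [hexp] at hpos
  have hfin : (∑ i, b i ^ 2) / (8 * B) =
      2 * t * ((∑ i, b i ^ 2) / 2) - t ^ 2 * (2 * B * ∑ i, b i ^ 2) := by
    rw [ht]; field_simp; ring
  have g1 := mul_le_mul_of_nonneg_left hXT (by positivity : 0 ≤ 2 * t)
  have g2 := mul_le_mul_of_nonneg_left hTT (by positivity : 0 ≤ t ^ 2)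
  rw [hfin]
  linarith

end Gram

theorem lintegral_tilt (τ : ℝ) : ∫⁻ y, ENNReal.ofReal (tilt τ y) ∂gaussianReal 0 1 = 1 := by
  rw [← ofReal_integral_eq_lintegral_ofReal (integrable_tilt τ)
    (.of_forall fun y => (tilt_pos τ y).le), integral_tilt, ENNReal.ofReal_one]

/-! ### Tilted moments of the aggregated activation -/

namespace ShortcutNet

variable (A : ShortcutNet) {d : ℕ}

/-- The first neuron of the first layer. -/
def firstNeuron (d : ℕ) : Fin (A.layerWidth d 1) := ⟨0, A.layerWidth_pos d le_rfl⟩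

/-- The weights and the bias of the first neuron of the first layer. -/
def firstRow (θ : A.Params d) : (Fin d → ℝ) × ℝ :=
  row (A.firstNeuron d) (θ ⟨0, A.depth_pos⟩)

theorem hidden_one (θ : A.Params d) (x : EuclideanSpace ℝ (Fin d)) (p : Fin (A.layerWidth d 1)) :
    A.hidden θ x 1 A.depth_pos p =
      relu (preact (ι := Fin d) x (row p (θ ⟨0, A.depth_pos⟩))) := rfl

theorem measurePreserving_evalLayer (v : ℝ≥0) (d : ℕ) :
    MeasurePreserving (fun θ : A.Params d => θ ⟨0, A.depth_pos⟩) (A.paramLaw v d)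
      (layerLaw v (A.layerWidth d 1) d) :=
  measurePreserving_eval
    (fun l : Fin A.depth => layerLaw v (A.layerWidth d (l + 1)) (A.layerWidth d l)) _

theorem measurePreserving_firstRow (v : ℝ≥0) (d : ℕ) :
    MeasurePreserving (fun θ : A.Params d => A.firstRow θ) (A.paramLaw v d) (rowLaw v (Fin d)) :=
  (measurePreserving_row v (A.firstNeuron d)).comp (A.measurePreserving_evalLayer v d)

/-- The normalized pre-activation of the first neuron of the first layer. -/
def firstPreact (v : ℝ≥0) (θ : A.Params d) (x : EuclideanSpace ℝ (Fin d)) : ℝ :=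
  stdPreact v x (A.firstRow θ)

theorem measurePreserving_firstPreact {v : ℝ≥0} (hv : 0 < v) (x : EuclideanSpace ℝ (Fin d)) :
    MeasurePreserving (fun θ => A.firstPreact v θ x) (A.paramLaw v d) (gaussianReal 0 1) :=
  (measurePreserving_stdPreact hv x).comp (A.measurePreserving_firstRow v d)

theorem isFirstLayerWeight_tilt (v : ℝ≥0) (τ : ℝ) (x : EuclideanSpace ℝ (Fin d)) :
    A.IsFirstLayerWeight fun θ => ENNReal.ofReal (tilt τ (A.firstPreact v θ x)) := by
  refine ⟨((measurable_tilt τ).comp ((measurable_stdPreact v x).comp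
    (A.measurePreserving_firstRow v d).measurable)).ennreal_ofReal, fun θ θ' h => ?_⟩
  simp only [firstPreact, firstRow, h]

/-- On the tilted neuron the bound is pointwise, by `relu_sq_mul_tilt_le`. Any other neuron is
independent of the tilt, which then integrates to 1. -/
theorem lintegral_tilt_mul_hidden_one_sq_le {v : ℝ≥0} (hv : 0 < v) {τ : ℝ} (hτ : τ ≤ 0)
    (x : EuclideanSpace ℝ (Fin d)) (p : Fin (A.layerWidth d 1)) :
    ∫⁻ θ, ENNReal.ofReal (tilt τ (A.firstPreact v θ x)) *
      ENNReal.ofReal (A.hidden θ x 1 A.depth_pos p ^ 2) ∂A.paramLaw v d ≤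
      ENNReal.ofReal (preactScale v x ^ 2) := by
  by_cases hp : p = A.firstNeuron d
  · have h1 : ∀ θ : A.Params d, ENNReal.ofReal (tilt τ (A.firstPreact v θ x)) *
        ENNReal.ofReal (A.hidden θ x 1 A.depth_pos p ^ 2) ≤
        ENNReal.ofReal (preactScale v x ^ 2 * A.firstPreact v θ x ^ 2) := fun θ => by
      rw [← ENNReal.ofReal_mul (tilt_pos _ _).le, hidden_one, hp]
      refine ENNReal.ofReal_le_ofReal ?_
      have h2 : preact (ι := Fin d) x (row (A.firstNeuron d) (θ ⟨0, A.depth_pos⟩)) =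
        preactScale v x * A.firstPreact v θ x := preact_eq_mul_stdPreact hv _ _
      rw [h2, relu_mul (preactScale_nonneg v x), mul_pow]
      have := mul_le_mul_of_nonneg_left (relu_sq_mul_tilt_le hτ (A.firstPreact v θ x))
        (sq_nonneg (preactScale v x))
      linarith
    refine (lintegral_mono h1).trans ?_
    rw [(A.measurePreserving_firstPreact hv x).lintegral_comp
      (f := fun y => ENNReal.ofReal (preactScale v x ^ 2 * y ^ 2)) (by fun_prop),
      ← ofReal_integral_eq_lintegral_ofReal (integrable_sq_gaussian.const_mul _)
        (.of_forall fun y => by positivity), integral_const_mul, integral_sq_gaussian, mul_one]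
  -- Resampling the first row separates the tilt from neuron `p`, whose row is unaffected.
  · set F : ((Fin (A.layerWidth d 1) → Fin d → ℝ) × (Fin (A.layerWidth d 1) → ℝ)) → ENNReal :=
      fun y => ENNReal.ofReal (tilt τ (stdPreact (ι := Fin d) v x (row (A.firstNeuron d) y))) *
        ENNReal.ofReal (relu (preact (ι := Fin d) x (row p y)) ^ 2) with hF
    have hm1 : ∀ p : Fin (A.layerWidth d 1), Measurable (fun y => row (m := d) p y) := fun p =>
      (measurePreserving_row v p).measurable
    have hFm : Measurable F := by
      refine Measurable.mul (Measurable.ennreal_ofReal ?_) (Measurable.ennreal_ofReal ?_)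
      · exact (measurable_tilt τ).comp ((measurable_stdPreact v _).comp (hm1 _))
      · exact (measurable_relu.comp ((measurable_preact _).comp (hm1 _))).pow_const 2
    have h1 : ∫⁻ θ, ENNReal.ofReal (tilt τ (A.firstPreact v θ x)) *
      ENNReal.ofReal (A.hidden θ x 1 A.depth_pos p ^ 2) ∂A.paramLaw v d =
        ∫⁻ y, F y ∂layerLaw v (A.layerWidth d 1) d :=
      (A.measurePreserving_evalLayer v d).lintegral_comp hFm
    have hF' := hFm.comp (measurePreserving_setRow v (m := d) (A.firstNeuron d)).measurable
    simp only [Function.comp_def] at hF'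
    rw [h1, ← (measurePreserving_setRow v (m := d) (A.firstNeuron d)).lintegral_comp hFm,
      lintegral_prod _ hF'.aemeasurable]
    have h2 : ∀ y w, F (setRow (A.firstNeuron d) y w) =
        ENNReal.ofReal (tilt τ (stdPreact (ι := Fin d) v x w)) *
        ENNReal.ofReal (relu (preact (ι := Fin d) x (row p y)) ^ 2) := fun y w => by
      simp only [hF, row_setRow, row_setRow_of_ne hp]
    have h3 : ∀ c : ENNReal, ∫⁻ w, ENNReal.ofReal (tilt τ (stdPreact (ι := Fin d) v x w)) * c
        ∂rowLaw v (Fin d) = c := fun c => by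
      have hm : Measurable fun y => ENNReal.ofReal (tilt τ y) := (measurable_tilt τ).ennreal_ofReal
      have hm' := hm.comp (measurable_stdPreact (ι := Fin d) v x)
      simp only [Function.comp_def] at hm'
      rw [lintegral_mul_const _ hm',
        (measurePreserving_stdPreact hv x).lintegral_comp hm, lintegral_tilt, one_mul]
    simp only [h2, h3]
    rw [(measurePreserving_row v p).lintegral_comp
      (f := fun w => ENNReal.ofReal (relu (preact (ι := Fin d) x w) ^ 2))
      ((measurable_relu.comp (measurable_preact _)).pow_const 2).ennreal_ofReal, preactScale_sq]
    exact lintegral_relu_preact_sq_le v _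

theorem lintegral_tilt_firstPreact {v : ℝ≥0} (hv : 0 < v) (τ : ℝ) (x : EuclideanSpace ℝ (Fin d)) :
    ∫⁻ θ, ENNReal.ofReal (tilt τ (A.firstPreact v θ x)) ∂A.paramLaw v d = 1 := by
  rw [(A.measurePreserving_firstPreact hv x).lintegral_comp
    (f := fun y => ENNReal.ofReal (tilt τ y)) (measurable_tilt τ).ennreal_ofReal, lintegral_tilt]

/-- The sum of all the neurons of the aggregated layers. -/
def act (θ : A.Params d) (x : EuclideanSpace ℝ (Fin d)) : ℝ :=
  ∑ k : Fin (A.last + 1), ∑ q, A.hidden θ x (A.first + k * A.sep) (A.shortcut_le k) q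

theorem one_le_shortcut (k : ℕ) : 1 ≤ A.first + k * A.sep :=
  A.first_pos.trans (Nat.le_add_right _ _)

theorem act_nonneg (θ : A.Params d) (x : EuclideanSpace ℝ (Fin d)) : 0 ≤ A.act θ x :=
  Finset.sum_nonneg fun k _ => Finset.sum_nonneg fun q _ =>
    A.hidden_nonneg θ x (A.one_le_shortcut k) _ q

theorem measurable_act (x : EuclideanSpace ℝ (Fin d)) :
    Measurable fun θ : A.Params d => A.act θ x :=
  Finset.measurable_fun_sum _ fun _ _ => Finset.measurable_fun_sum _ fun q _ =>
    A.measurable_hidden x _ _ q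

theorem ofReal_act_sq_le (θ : A.Params d) (x : EuclideanSpace ℝ (Fin d)) :
    ENNReal.ofReal (A.act θ x ^ 2) ≤ ∑ k : Fin (A.last + 1),
      ((A.last + 1) * A.width (A.first + k * A.sep) : ℝ≥0) *
        A.normSq θ x (A.first + k * A.sep) (A.shortcut_le k) := by
  have h1 : A.act θ x ^ 2 ≤ ∑ k : Fin (A.last + 1),
      ((A.last + 1) * A.width (A.first + k * A.sep) : ℝ≥0) *
        ∑ q, A.hidden θ x (A.first + k * A.sep) (A.shortcut_le k) q ^ 2 := by
    refine sq_sum_le_card_mul_sum_sq.trans ?_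
    rw [Finset.mul_sum]
    refine Finset.sum_le_sum fun k _ => ?_
    rw [Finset.card_univ, Fintype.card_fin]
    push_cast
    rw [mul_assoc]
    refine mul_le_mul_of_nonneg_left (sq_sum_le_card_mul_sum_sq.trans ?_) (by positivity)
    rw [Finset.card_univ, Fintype.card_fin]
    exact mul_le_mul_of_nonneg_right
      (Nat.cast_le.mpr (A.layerWidth_of_pos d (A.one_le_shortcut k)).le)
      (Finset.sum_nonneg fun q _ => sq_nonneg _)
  refine (ENNReal.ofReal_le_ofReal h1).trans ?_
  rw [ENNReal.ofReal_sum_of_nonneg fun k _ => mul_nonneg (NNReal.coe_nonneg _)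
    (Finset.sum_nonneg fun q _ => sq_nonneg _)]
  refine Finset.sum_le_sum fun k _ => ?_
  rw [ENNReal.ofReal_mul (NNReal.coe_nonneg _), ENNReal.ofReal_coe_nnreal, normSq,
    ENNReal.ofReal_sum_of_nonneg fun q _ => sq_nonneg _]

/-- Cauchy–Schwarz reduces to squared layer norms, and these to layer 1 with the tilt as first-layer
weight. The additive constants from the biases are absorbed by `preactScale² ≥ v`, whence the `v⁻¹`.
-/
theorem exists_lintegral_tilt_mul_act_sq_le {v : ℝ≥0} (hv : 0 < v) :
    ∃ C : ℝ≥0, ∀ (d : ℕ) (x : EuclideanSpace ℝ (Fin d)) (τ : ℝ), τ ≤ 0 →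
      ∫⁻ θ, ENNReal.ofReal (tilt τ (A.firstPreact v θ x)) * ENNReal.ofReal (A.act θ x ^ 2)
        ∂A.paramLaw v d ≤ C * ENNReal.ofReal (preactScale v x ^ 2) := by
  choose C hC using fun k : Fin (A.last + 1) =>
    A.exists_lintegral_mul_normSq_le v (A.one_le_shortcut k)
  refine ⟨∑ k : Fin (A.last + 1), ((A.last + 1) * A.width (A.first + k * A.sep) : ℝ≥0) *
    (C k * (A.width 1 + v⁻¹)), fun d x τ hτ => ?_⟩
  have hG := A.isFirstLayerWeight_tilt (d := d) v τ x
  set G : A.Params d → ENNReal := fun θ => ENNReal.ofReal (tilt τ (A.firstPreact v θ x)) with hGdef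
  have h1 : ∫⁻ θ, G θ * A.normSq θ x 1 A.depth_pos ∂A.paramLaw v d ≤
      A.width 1 * ENNReal.ofReal (preactScale v x ^ 2) := by
    have e : ∫⁻ θ, G θ * A.normSq θ x 1 A.depth_pos ∂A.paramLaw v d =
        ∑ p, ∫⁻ θ, G θ * ENNReal.ofReal (A.hidden θ x 1 A.depth_pos p ^ 2) ∂A.paramLaw v d := by
      simp only [normSq, Finset.mul_sum]
      exact lintegral_finsetSum _ fun p _ =>
        hG.1.mul ((A.measurable_hidden x _ _ p).pow_const 2).ennreal_ofReal
    rw [e]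
    refine (Finset.sum_le_sum fun p _ =>
      A.lintegral_tilt_mul_hidden_one_sq_le hv hτ x p).trans ?_
    rw [Finset.sum_const, Finset.card_univ, Fintype.card_fin, nsmul_eq_mul,
      A.layerWidth_of_pos d le_rfl]
  have h2 : ∫⁻ θ, G θ ∂A.paramLaw v d ≤ (v⁻¹ : ℝ≥0) * ENNReal.ofReal (preactScale v x ^ 2) := by
    rw [A.lintegral_tilt_firstPreact hv, ← ENNReal.ofReal_coe_nnreal,
      ← ENNReal.ofReal_mul (NNReal.coe_nonneg _), preactScale_sq, ← ENNReal.ofReal_one]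
    refine ENNReal.ofReal_le_ofReal ?_
    have hv' : (0 : ℝ) < v := hv
    rw [NNReal.coe_inv, ← mul_assoc, inv_mul_cancel₀ hv'.ne', one_mul]
    linarith [Finset.sum_nonneg fun q (_ : q ∈ Finset.univ) => sq_nonneg (x q)]
  calc _ ≤ ∫⁻ θ, ∑ k : Fin (A.last + 1),
      ((A.last + 1) * A.width (A.first + k * A.sep) : ℝ≥0) *
        (G θ * A.normSq θ x (A.first + k * A.sep) (A.shortcut_le k)) ∂A.paramLaw v d := by
        refine lintegral_mono fun θ => ?_
        refine (mul_le_mul_right (A.ofReal_act_sq_le θ x) _).trans ?_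
        rw [Finset.mul_sum]
        exact (Finset.sum_congr rfl fun k _ => mul_left_comm _ _ _).le
    _ = ∑ k : Fin (A.last + 1), ((A.last + 1) * A.width (A.first + k * A.sep) : ℝ≥0) *
        ∫⁻ θ, G θ * A.normSq θ x (A.first + k * A.sep) (A.shortcut_le k) ∂A.paramLaw v d := by
        have hm : ∀ k : Fin (A.last + 1), Measurable fun θ =>
            G θ * A.normSq θ x (A.first + k * A.sep) (A.shortcut_le k) := fun k =>
          hG.1.mul (A.measurable_normSq x _ _)
        rw [lintegral_finsetSum _ fun k _ => (hm k).const_mul _]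
        exact Finset.sum_congr rfl fun k _ => lintegral_const_mul _ (hm k)
    _ ≤ ∑ k : Fin (A.last + 1), ((A.last + 1) * A.width (A.first + k * A.sep) : ℝ≥0) *
        ((C k * (A.width 1 + v⁻¹) : ℝ≥0) * ENNReal.ofReal (preactScale v x ^ 2)) := by
        refine Finset.sum_le_sum fun k _ => mul_le_mul_right ?_ _
        refine (hC k _ d x G hG).trans ?_
        push_cast
        rw [mul_assoc, add_mul]
        exact mul_le_mul_right (add_le_add h1 h2) _
    _ = _ := by
        push_cast
        rw [Finset.sum_mul]
        exact Finset.sum_congr rfl fun k _ => by ring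

/-- All neurons are nonnegative, so a single neuron of layer `first` bounds `act` below; its tilted
mean is traced back to the first neuron of layer 1, where `le_integral_relu_mul_tilt` applies. -/
theorem exists_le_lintegral_tilt_mul_act {v : ℝ≥0} (hv : 0 < v) :
    ∃ c : ℝ≥0, 0 < c ∧ ∀ (d : ℕ) (x : EuclideanSpace ℝ (Fin d)) (τ : ℝ),
      ENNReal.ofReal (c * (preactScale v x * τ)) ≤
      ∫⁻ θ, ENNReal.ofReal (tilt τ (A.firstPreact v θ x)) * ENNReal.ofReal (A.act θ x)
        ∂A.paramLaw v d := by
  obtain ⟨c, hc, hC⟩ := A.exists_le_lintegral_mul_hidden hv A.first_pos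
  refine ⟨c, hc, fun d x τ => ?_⟩
  have h1 := hC (le_trans (Nat.le_add_right _ _) A.le_depth) d x _
    (A.isFirstLayerWeight_tilt v τ x)
  have h2 : ∫⁻ θ, ENNReal.ofReal (tilt τ (A.firstPreact v θ x)) *
      ENNReal.ofReal (A.hidden θ x 1 A.depth_pos ⟨0, A.layerWidth_pos d le_rfl⟩)
        ∂A.paramLaw v d =
      ENNReal.ofReal (preactScale v x * ∫ y, relu y * tilt τ y ∂gaussianReal 0 1) := by
    rw [← integral_const_mul, ofReal_integral_eq_lintegral_ofReal
      ((integrable_relu_mul_tilt τ).const_mul _) (.of_forall fun y =>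
        mul_nonneg (preactScale_nonneg v x) (mul_nonneg (relu_nonneg y) (tilt_pos τ y).le)),
      ← (A.measurePreserving_firstPreact hv x).lintegral_comp
      ((measurable_relu.fun_mul (measurable_tilt τ)).const_mul _).ennreal_ofReal]
    refine lintegral_congr fun θ => ?_
    have h2 : preact (ι := Fin d) x (row ⟨0, A.layerWidth_pos d le_rfl⟩ (θ ⟨0, A.depth_pos⟩)) =
        preactScale v x * A.firstPreact v θ x := preact_eq_mul_stdPreact hv _ _
    rw [← ENNReal.ofReal_mul (tilt_pos _ _).le, hidden_one, h2, relu_mul (preactScale_nonneg v x)]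
    congr 1
    ring
  rw [h2] at h1
  refine le_trans ?_ (h1.trans (lintegral_mono fun θ => mul_le_mul_right
    (ENNReal.ofReal_le_ofReal ?_) _))
  · rw [ENNReal.ofReal_mul c.coe_nonneg, ENNReal.ofReal_coe_nnreal]
    refine mul_le_mul_right (ENNReal.ofReal_le_ofReal ?_) _
    exact mul_le_mul_of_nonneg_left (le_integral_relu_mul_tilt τ) (preactScale_nonneg v x)
  · have e0 : ∀ k : Fin (A.last + 1),
        0 ≤ ∑ q, A.hidden θ x (A.first + k * A.sep) (A.shortcut_le k) q := fun k =>
      Finset.sum_nonneg fun q _ => A.hidden_nonneg θ x (A.one_le_shortcut k) _ q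
    refine le_trans ?_ (Finset.single_le_sum (fun k _ => e0 k) (Finset.mem_univ 0))
    -- Generalizing over `l = first` avoids a cast between the types indexed by `first + 0 * sep`
    -- and by `first`.
    have key : ∀ (l : ℕ) (h : l ≤ A.depth) (hl : l = A.first),
        A.hidden θ x A.first (hl ▸ h) ⟨0, A.layerWidth_pos d A.first_pos⟩ ≤
          ∑ q, A.hidden θ x l h q := by
      intro l h hl
      subst hl
      exact Finset.single_le_sum (f := fun q => A.hidden θ x A.first h q)
        (fun q _ => A.hidden_nonneg θ x A.first_pos _ q) (Finset.mem_univ _)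
    exact key _ (A.shortcut_le 0) (by simp)

end ShortcutNet

/-! ### Isolating the first neuron and pairing with the test functions -/

namespace ShortcutNet

variable (A : ShortcutNet) {d : ℕ}

/-- Replace the weights and biases of the first layer. -/
def resample (θ : A.Params d) (y : (Fin (A.layerWidth d 1) → Fin d → ℝ) ×
    (Fin (A.layerWidth d 1) → ℝ)) (w : (Fin d → ℝ) × ℝ) : A.Params d :=
  Function.update θ ⟨0, A.depth_pos⟩ (setRow (A.firstNeuron d) y w)

theorem measurePreserving_resample (v : ℝ≥0) (d : ℕ) :
    MeasurePreserving
      (fun u : (A.Params d × ((Fin (A.layerWidth d 1) → Fin d → ℝ) ×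
          (Fin (A.layerWidth d 1) → ℝ))) × ((Fin d → ℝ) × ℝ) => A.resample u.1.1 u.1.2 u.2)
      (((A.paramLaw v d).prod (layerLaw v (A.layerWidth d 1) d)).prod (rowLaw v (Fin d)))
      (A.paramLaw v d) :=
  ((A.measurePreserving_updateLayer v d ⟨0, A.depth_pos⟩).comp
    ((MeasurePreserving.id (A.paramLaw v d)).prod
      (measurePreserving_setRow v (m := d) (A.firstNeuron d)))).comp
    (measurePreserving_prodAssoc _ _ _)

section Resample

variable (θ : A.Params d) (y : (Fin (A.layerWidth d 1) → Fin d → ℝ) ×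
  (Fin (A.layerWidth d 1) → ℝ)) (w : (Fin d → ℝ) × ℝ)

theorem resample_first :
    A.resample θ y w ⟨0, A.depth_pos⟩ = setRow (m := d) (A.firstNeuron d) y w :=
  Function.update_self (β := fun l : Fin A.depth =>
    (Fin (A.layerWidth d (l + 1)) → Fin (A.layerWidth d l) → ℝ) ×
      (Fin (A.layerWidth d (l + 1)) → ℝ)) _ _ _

theorem resample_of_pos {l : Fin A.depth} (hl : 1 ≤ (l : ℕ)) : A.resample θ y w l = θ l :=
  Function.update_of_ne (fun h => by rw [h] at hl; exact absurd hl (by simp)) _ _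

theorem firstRow_resample : A.firstRow (A.resample θ y w) = w := by
  have h := congrArg (row (m := d) (A.firstNeuron d)) (A.resample_first θ y w)
  rw [row_setRow] at h
  exact h

theorem hidden_one_resample (x : EuclideanSpace ℝ (Fin d)) (p : Fin (A.layerWidth d 1)) :
    A.hidden (A.resample θ y w) x 1 A.depth_pos p =
      relu (preact (ι := Fin d) x (row (m := d) p (setRow (A.firstNeuron d) y w))) :=
  congrArg (fun u => relu (preact (ι := Fin d) x (row (m := d) p u))) (A.resample_first θ y w)

/-- The network sees the weights of a first-layer neuron only through its pre-activation. -/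
theorem act_resample (x : EuclideanSpace ℝ (Fin d)) :
    A.act (A.resample θ y w) x = A.act (A.resample θ y (0, preact (ι := Fin d) x w)) x := by
  -- Zero weights with bias `preact x w` reproduce the same pre-activation at `x`, so layer 1 is
  -- unchanged and later layers follow.
  have h1 : A.hidden (A.resample θ y w) x 1 A.depth_pos =
      A.hidden (A.resample θ y (0, preact (ι := Fin d) x w)) x 1 A.depth_pos := by
    funext p
    rw [hidden_one_resample, hidden_one_resample]
    by_cases hp : p = A.firstNeuron d
    · subst hp
      rw [row_setRow, row_setRow]
      simp [preact]
    · rw [row_setRow_of_ne hp, row_setRow_of_ne hp]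
  refine Finset.sum_congr rfl fun k _ => Finset.sum_congr rfl fun q _ => ?_
  rw [A.hidden_congr_of_first _ _ x x A.depth_pos h1 (fun l hl => ?_) _ (A.one_le_shortcut k)]
  rw [resample_of_pos _ _ _ _ hl, resample_of_pos _ _ _ _ hl]

end Resample

theorem exists_second_moment_le {v : ℝ≥0} (hv : 0 < v) :
    ∃ C : ℝ, 0 < C ∧ ∀ (d : ℕ) (x : EuclideanSpace ℝ (Fin d)) (τ : ℝ), τ ≤ 0 →
      Integrable (fun θ => tilt τ (A.firstPreact v θ x) * A.act θ x ^ 2) (A.paramLaw v d) ∧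
      ∫ θ, tilt τ (A.firstPreact v θ x) * A.act θ x ^ 2 ∂A.paramLaw v d ≤
        C * preactScale v x ^ 2 := by
  obtain ⟨C, hC⟩ := A.exists_lintegral_tilt_mul_act_sq_le hv
  refine ⟨C + 1, by positivity, fun d x τ hτ => ?_⟩
  have h := hC d x τ hτ
  simp only [← ENNReal.ofReal_mul (tilt_pos _ _).le] at h
  have hm : Measurable fun θ => tilt τ (A.firstPreact v θ x) * A.act θ x ^ 2 :=
    ((measurable_tilt τ).comp (A.measurePreserving_firstPreact hv x).measurable).mul
      ((A.measurable_act x).pow_const 2)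
  have hn : ∀ θ : A.Params d, 0 ≤ tilt τ (A.firstPreact v θ x) * A.act θ x ^ 2 := fun θ =>
    mul_nonneg (tilt_pos _ _).le (sq_nonneg _)
  have hfin : ∫⁻ θ, ENNReal.ofReal (tilt τ (A.firstPreact v θ x) * A.act θ x ^ 2)
      ∂A.paramLaw v d < ⊤ :=
    h.trans_lt (ENNReal.mul_lt_top ENNReal.coe_lt_top ENNReal.ofReal_lt_top)
  have hi : Integrable (fun θ => tilt τ (A.firstPreact v θ x) * A.act θ x ^ 2)
      (A.paramLaw v d) :=
    ⟨hm.aestronglyMeasurable, by rwa [hasFiniteIntegral_iff_ofReal (.of_forall hn)]⟩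
  refine ⟨hi, ?_⟩
  rw [integral_eq_lintegral_of_nonneg_ae (.of_forall hn) hm.aestronglyMeasurable]
  refine (ENNReal.toReal_mono (ENNReal.mul_lt_top ENNReal.coe_lt_top ENNReal.ofReal_lt_top).ne
    h).trans ?_
  rw [ENNReal.toReal_mul, ENNReal.coe_toReal, ENNReal.toReal_ofReal (sq_nonneg _)]
  nlinarith [sq_nonneg (preactScale v x)]

theorem tilt_zero (y : ℝ) : tilt 0 y = 1 := by simp [tilt]

theorem memLp_act {v : ℝ≥0} (hv : 0 < v) (x : EuclideanSpace ℝ (Fin d)) :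
    MemLp (fun θ => A.act θ x) 2 (A.paramLaw v d) := by
  obtain ⟨C, -, hC⟩ := A.exists_second_moment_le hv
  rw [memLp_two_iff_integrable_sq (A.measurable_act x).aestronglyMeasurable]
  simpa [tilt_zero] using (hC d x 0 le_rfl).1

theorem integrable_act_mul_tilt {v : ℝ≥0} (hv : 0 < v) (x x' : EuclideanSpace ℝ (Fin d)) (τ : ℝ) :
    Integrable (fun θ => A.act θ x * tilt τ (A.firstPreact v θ x')) (A.paramLaw v d) :=
  (A.memLp_act hv x).integrable_mul
    ((memLp_tilt τ).comp_measurePreserving (A.measurePreserving_firstPreact hv x'))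

/-- Conditionally on everything but the first row, `act` at `x` is a function of that row's
pre-activation at `x`; the one-neuron exchange applies, and the correlation does not depend on the
conditioning. -/
theorem integral_act_mul_tilt_exchange {v : ℝ≥0} (hv : 0 < v) (x x' : EuclideanSpace ℝ (Fin d))
    (τ : ℝ) :
    ∫ θ, A.act θ x * tilt τ (A.firstPreact v θ x') ∂A.paramLaw v d =
      ∫ θ, A.act θ x * tilt (τ * preactCorr (ι := Fin d) v x x') (A.firstPreact v θ x)
        ∂A.paramLaw v d := by
  have hR := A.measurePreserving_resample v d
  have key : ∀ (y : EuclideanSpace ℝ (Fin d)) (t : ℝ),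
      ∫ θ, A.act θ x * tilt t (A.firstPreact v θ y) ∂A.paramLaw v d =
      ∫ u, ∫ w, A.act (A.resample u.1 u.2 (0, preact (ι := Fin d) x w)) x *
          tilt t (stdPreact (ι := Fin d) v y w) ∂rowLaw v (Fin d)
        ∂((A.paramLaw v d).prod (layerLaw v (A.layerWidth d 1) d)) := by
    intro y t
    have hi := A.integrable_act_mul_tilt hv x y t
    have hi' := hR.integrable_comp_of_integrable hi
    rw [← hR.map_eq] at hi
    simp only [Function.comp_def] at hi'
    have e1 := integral_map hR.measurable.aemeasurable hi.aestronglyMeasurable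
    rw [hR.map_eq] at e1
    rw [e1, integral_prod _ hi']
    refine integral_congr_ae (.of_forall fun u => integral_congr_ae (.of_forall fun w => ?_))
    simp only
    rw [← A.act_resample u.1 u.2 w x, firstPreact, firstRow_resample]
  rw [key, key]
  refine integral_congr_ae (.of_forall fun u => ?_)
  refine integral_mul_tilt_exchange hv (ι := Fin d) x x' τ
    (Φ := fun t => A.act (A.resample u.1 u.2 (0, t)) x) ?_
  exact (A.measurable_act x).comp (hR.measurable.comp (f := fun t : ℝ => (u, ((0 : Fin d → ℝ), t)))
    (by fun_prop))

/-- The sum of the aggregated neurons correlates with the test function of the same input, and its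
correlations with the test functions of other inputs decay with order `r`. -/
theorem exists_testFun_bounds {v : ℝ≥0} (hv : 0 < v) {r : ℕ} (hr : 1 ≤ r) :
    ∃ Λ B : ℝ, 0 ≤ Λ ∧ 1 ≤ B ∧ ∀ (d : ℕ) (x x' : EuclideanSpace ℝ (Fin d)),
      preactScale v x ≤
        ∫ θ, A.act θ x * testFun r Λ 1 (A.firstPreact v θ x) ∂A.paramLaw v d ∧
      |∫ θ, A.act θ x * testFun r Λ 1 (A.firstPreact v θ x') ∂A.paramLaw v d| ≤
        B * |preactCorr (ι := Fin d) v x x'| ^ r * preactScale v x ∧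
      |∫ θ, testFun r Λ 1 (A.firstPreact v θ x) * testFun r Λ 1 (A.firstPreact v θ x')
        ∂A.paramLaw v d| ≤ B * |preactCorr (ι := Fin d) v x x'| ^ r := by
  obtain ⟨C, hC0, hC⟩ := A.exists_second_moment_le hv
  obtain ⟨c, hc0, hc⟩ := A.exists_le_lintegral_tilt_mul_act hv
  have hc0' : (0 : ℝ) < c := hc0
  -- First moments follow from second ones through `a ≤ a²/s + s` with `s = preactScale v x`, the
  -- tilt having total mass 1.
  have hU : ∀ (d : ℕ) (x : EuclideanSpace ℝ (Fin d)) (τ : ℝ), τ ≤ 0 →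
      ∫ θ, A.act θ x * tilt τ (A.firstPreact v θ x) ∂A.paramLaw v d ≤
        (C + 1) * preactScale v x := by
    intro d x τ hτ
    have hs := preactScale_pos (ι := Fin d) hv x
    obtain ⟨hi, hle⟩ := hC d x τ hτ
    have hti : Integrable (fun θ => tilt τ (A.firstPreact v θ x)) (A.paramLaw v d) :=
      (A.measurePreserving_firstPreact hv x).integrable_comp_of_integrable (integrable_tilt τ)
    have ht : ∫ θ, tilt τ (A.firstPreact v θ x) ∂A.paramLaw v d = 1 := by
      rw [← integral_tilt τ, ← (A.measurePreserving_firstPreact hv x).map_eq, integral_map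
        (A.measurePreserving_firstPreact hv x).measurable.aemeasurable
        (measurable_tilt τ).aestronglyMeasurable]
    calc _ ≤ ∫ θ, ((preactScale v x)⁻¹ * (tilt τ (A.firstPreact v θ x) * A.act θ x ^ 2) +
          preactScale v x * tilt τ (A.firstPreact v θ x)) ∂A.paramLaw v d := by
          refine integral_mono (A.integrable_act_mul_tilt hv x x τ)
            ((hi.const_mul _).add (hti.const_mul _)) fun θ => ?_
          have htp := tilt_pos τ (A.firstPreact v θ x)
          have h1 : A.act θ x ≤ (preactScale v x)⁻¹ * A.act θ x ^ 2 + preactScale v x := by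
            rw [inv_mul_eq_div, ← sub_nonneg]
            have : A.act θ x ^ 2 / preactScale v x + preactScale v x - A.act θ x =
              ((A.act θ x - preactScale v x / 2) ^ 2 + 3 / 4 * preactScale v x ^ 2)
                / preactScale v x := by field_simp; ring
            rw [this]; positivity
          have := mul_le_mul_of_nonneg_right h1 htp.le
          simp only
          linarith
      _ = (preactScale v x)⁻¹ * (∫ θ, tilt τ (A.firstPreact v θ x) * A.act θ x ^ 2
            ∂A.paramLaw v d) + preactScale v x := by
          rw [integral_add (hi.const_mul _) (hti.const_mul _), integral_const_mul,
            integral_const_mul, ht, mul_one]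
      _ ≤ (preactScale v x)⁻¹ * (C * preactScale v x ^ 2) + preactScale v x := by gcongr
      _ = _ := by field_simp
  have hLow : ∀ (d : ℕ) (x : EuclideanSpace ℝ (Fin d)) (τ : ℝ), 0 ≤ τ →
      c * (preactScale v x * τ) ≤
        ∫ θ, A.act θ x * tilt τ (A.firstPreact v θ x) ∂A.paramLaw v d := by
    intro d x τ hτ
    have h := hc d x τ
    have hn : ∀ θ : A.Params d, 0 ≤ A.act θ x * tilt τ (A.firstPreact v θ x) := fun θ =>
      mul_nonneg (A.act_nonneg θ x) (tilt_pos _ _).le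
    simp only [← ENNReal.ofReal_mul (tilt_pos _ _).le, mul_comm (tilt _ _)] at h
    rw [← ofReal_integral_eq_lintegral_ofReal (A.integrable_act_mul_tilt hv x x τ)
      (.of_forall hn)] at h
    exact (ENNReal.ofReal_le_ofReal_iff (integral_nonneg hn)).mp h
  -- Chosen so that the term at tilt `Λ`, at least `c Λ s`, exceeds by `s` the total of the others:
  -- their binomial weights sum to at most `2^r` and each integral is at most `(C + 1) s`.
  set Λ : ℝ := (1 + 2 ^ r * (C + 1)) / c with hΛ
  have hΛ0 : 0 ≤ Λ := by positivity
  set B₁ : ℝ := ∫ y, testEnvelope r Λ y ^ 2 ∂gaussianReal 0 1 with hB₁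
  have hB₁0 : 0 ≤ B₁ := integral_nonneg fun y => sq_nonneg _
  -- `B₁` bounds the pairings of test functions, `B₁ + C` those with `act`, and the 1 ensures `1 ≤
  -- B`.
  refine ⟨Λ, 1 + B₁ + C, hΛ0, by linarith, fun d x x' => ?_⟩
  have hs := preactScale_pos (ι := Fin d) hv x
  have hmp := A.measurePreserving_firstPreact hv x
  set ρ := preactCorr (ι := Fin d) v x x' with hρ
  have hρ1 : |ρ| ≤ 1 := abs_preactCorr_le_one hv _ _
  refine ⟨?_, ?_, ?_⟩
  · have e : ∀ θ : A.Params d, A.act θ x * testFun r Λ 1 (A.firstPreact v θ x) =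
        ∑ j ∈ Finset.range (r + 1), ((-1) ^ j * (r.choose j : ℝ)) *
          (A.act θ x * tilt (Λ * (1 - j)) (A.firstPreact v θ x)) := by
      intro θ
      rw [testFun, Finset.mul_sum]
      exact Finset.sum_congr rfl fun j _ => by rw [mul_one]; ring
    simp only [e]
    rw [integral_finsetSum _ fun j _ => (A.integrable_act_mul_tilt hv x x _).const_mul _]
    simp only [integral_const_mul]
    -- Isolates `j = 0`, the only positive tilt; the remaining ones `Λ (1 - (j + 1)) = -Λ j` are
    -- nonpositive.
    rw [Finset.sum_range_succ', add_comm]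
    have h0 := hLow d x Λ hΛ0
    have hrest : |∑ j ∈ Finset.range r, ((-1) ^ (j + 1) * (r.choose (j + 1) : ℝ)) *
        ∫ θ, A.act θ x * tilt (Λ * (1 - (j + 1 : ℕ))) (A.firstPreact v θ x) ∂A.paramLaw v d| ≤
        2 ^ r * ((C + 1) * preactScale v x) := by
      refine (Finset.abs_sum_le_sum_abs _ _).trans ?_
      have hbin := sum_abs_signed_choose r
      rw [Finset.sum_range_succ'] at hbin
      have hbin' : ∑ j ∈ Finset.range r, |((-1) ^ (j + 1) * (r.choose (j + 1) : ℝ))| ≤ 2 ^ r := by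
        rw [← hbin]
        exact le_add_of_nonneg_right (abs_nonneg _)
      refine le_trans ?_ (mul_le_mul_of_nonneg_right hbin' (by positivity))
      rw [Finset.sum_mul]
      refine Finset.sum_le_sum fun j _ => ?_
      rw [abs_mul]
      refine mul_le_mul_of_nonneg_left ?_ (abs_nonneg _)
      rw [abs_of_nonneg (integral_nonneg fun θ =>
        mul_nonneg (A.act_nonneg θ x) (tilt_pos _ _).le)]
      refine hU d x _ (mul_nonpos_of_nonneg_of_nonpos hΛ0 ?_)
      push_cast
      linarith [(Nat.cast_nonneg j : (0 : ℝ) ≤ j)]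
    have hΛc : c * (preactScale v x * Λ) =
        preactScale v x + 2 ^ r * ((C + 1) * preactScale v x) := by
      rw [hΛ]; field_simp
    have := (abs_le.mp hrest).1
    simp only [pow_zero, Nat.choose_zero_right, Nat.cast_one, one_mul, Nat.cast_zero, sub_zero,
      mul_one]
    linarith
  · rw [integral_mul_testFun_exchange (A.integrable_act_mul_tilt hv x x')
      (A.integrable_act_mul_tilt hv x x) (A.integral_act_mul_tilt_exchange hv x x'),
      ← Real.norm_eq_abs]
    obtain ⟨hi, hle⟩ := hC d x 0 le_rfl
    simp only [tilt_zero, one_mul] at hi hle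
    have he2 : Integrable (fun θ => testEnvelope r Λ (A.firstPreact v θ x) ^ 2) (A.paramLaw v d) :=
      ((memLp_testEnvelope r Λ).comp_measurePreserving hmp).integrable_sq
    have he2' : ∫ θ, testEnvelope r Λ (A.firstPreact v θ x) ^ 2 ∂A.paramLaw v d = B₁ := by
      rw [hB₁, ← hmp.map_eq, integral_map hmp.measurable.aemeasurable]
      rw [hmp.map_eq]
      exact (memLp_testEnvelope r Λ).integrable_sq.aestronglyMeasurable
    have hbound : ∀ θ : A.Params d, ‖A.act θ x * testFun r Λ ρ (A.firstPreact v θ x)‖ ≤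
        |ρ| ^ r * ((preactScale v x)⁻¹ * A.act θ x ^ 2 +
          preactScale v x * testEnvelope r Λ (A.firstPreact v θ x) ^ 2) := by
      intro θ
      rw [Real.norm_eq_abs, abs_mul, abs_of_nonneg (A.act_nonneg θ x)]
      have h1 : |testFun r Λ ρ (A.firstPreact v θ x)| ≤
        |ρ| ^ r * testEnvelope r Λ (A.firstPreact v θ x) := abs_testFun_le hr hΛ0 hρ1 _
      set E := testEnvelope r Λ (A.firstPreact v θ x)
      have h2 : A.act θ x * E ≤ (preactScale v x)⁻¹ * A.act θ x ^ 2 + preactScale v x * E ^ 2 := by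
        rw [inv_mul_eq_div, ← sub_nonneg]
        have : A.act θ x ^ 2 / preactScale v x + preactScale v x * E ^ 2 - A.act θ x * E =
            ((A.act θ x - preactScale v x * E / 2) ^ 2 + 3 / 4 * (preactScale v x * E) ^ 2)
              / preactScale v x := by field_simp; ring
        rw [this]; positivity
      calc _ ≤ A.act θ x * (|ρ| ^ r * E) := mul_le_mul_of_nonneg_left h1 (A.act_nonneg θ x)
        _ = |ρ| ^ r * (A.act θ x * E) := by ring
        _ ≤ _ := by gcongr
    refine (norm_integral_le_of_norm_le (((hi.const_mul _).add (he2.const_mul _)).const_mul _)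
      (.of_forall hbound)).trans ?_
    rw [integral_const_mul]
    have h3 : ∫ θ, ((preactScale v x)⁻¹ * A.act θ x ^ 2 +
          preactScale v x * testEnvelope r Λ (A.firstPreact v θ x) ^ 2) ∂A.paramLaw v d ≤
        (1 + B₁ + C) * preactScale v x := by
      rw [integral_add (hi.const_mul _) (he2.const_mul _), integral_const_mul, integral_const_mul,
        he2']
      calc _ ≤ (preactScale v x)⁻¹ * (C * preactScale v x ^ 2) + preactScale v x * B₁ := by gcongr
        _ = (C + B₁) * preactScale v x := by field_simp
        _ ≤ _ := by nlinarith
    calc _ ≤ |ρ| ^ r * ((1 + B₁ + C) * preactScale v x) := mul_le_mul_of_nonneg_left h3 (by positivity)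
      _ = _ := by ring
  · have h1 : ∫ θ, testFun r Λ 1 (A.firstPreact v θ x) * testFun r Λ 1 (A.firstPreact v θ x')
        ∂A.paramLaw v d = ∫ w, testFun r Λ 1 (stdPreact (ι := Fin d) v x w) *
          testFun r Λ 1 (stdPreact (ι := Fin d) v x' w) ∂rowLaw v (Fin d) := by
      have hr' := A.measurePreserving_firstRow v d
      rw [← hr'.map_eq, integral_map hr'.measurable.aemeasurable]
      · rfl
      · exact (((measurable_testFun r Λ 1).comp (measurable_stdPreact v _)).mul
          ((measurable_testFun r Λ 1).comp (measurable_stdPreact v _))).aestronglyMeasurable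
    rw [h1]
    refine (abs_integral_testFun_mul_testFun_le hv hr hΛ0 _ _).trans ?_
    rw [mul_comm]
    exact mul_le_mul_of_nonneg_right (by linarith) (by positivity)

/-! ### The kernel as a Gram form -/

/-- The number of neurons in the aggregated layers. -/
def mass : ℝ := ∑ k : Fin (A.last + 1), (A.width (A.first + k * A.sep) : ℝ)

theorem aggregatedCount_eq (d : ℕ) : (A.aggregatedCount d : ℝ) = A.mass := by
  rw [aggregatedCount, mass]
  push_cast
  exact Finset.sum_congr rfl fun k _ => by rw [A.layerWidth_of_pos d (A.one_le_shortcut k)]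

theorem mass_pos : 0 < A.mass :=
  Finset.sum_pos (fun k _ => by exact_mod_cast A.width_pos _) Finset.univ_nonempty

theorem output_apply (θ : A.Params d) (x : EuclideanSpace ℝ (Fin d)) (o : Fin A.outDim) :
    A.output θ x o = 1 / Real.sqrt A.mass * A.act θ x := by
  simp only [output, aggregatedCount_eq, Pi.smul_apply, Finset.sum_apply,
    smul_eq_mul, Matrix.mulVec, dotProduct, Matrix.of_apply, one_mul, act]

theorem inner_output (θ : A.Params d) (x x' : EuclideanSpace ℝ (Fin d)) :
    inner ℝ (A.output θ x) (A.output θ x') = A.outDim / A.mass * (A.act θ x * A.act θ x') := by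
  rw [PiLp.inner_apply]
  simp only [output_apply, RCLike.inner_apply, conj_trivial, Finset.sum_const, Finset.card_univ,
    Fintype.card_fin, nsmul_eq_mul]
  have h := Real.mul_self_sqrt A.mass_pos.le
  have h' := (Real.sqrt_pos.mpr A.mass_pos).ne'
  have e : A.outDim / A.mass * (A.act θ x * A.act θ x') =
      A.outDim / (Real.sqrt A.mass * Real.sqrt A.mass) * (A.act θ x * A.act θ x') := by rw [h]
  rw [e]
  field_simp

theorem kernel_eq (v : ℝ≥0) (x x' : EuclideanSpace ℝ (Fin d)) :
    A.kernel v x x' = A.outDim / A.mass * ∫ θ, A.act θ x * A.act θ x' ∂A.paramLaw v d := by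
  simp only [kernel, inner_output, integral_const_mul]

theorem kernel_comm (v : ℝ≥0) (x x' : EuclideanSpace ℝ (Fin d)) :
    A.kernel v x x' = A.kernel v x' x := by
  simp only [kernel_eq, mul_comm (A.act _ x)]

theorem kernel_form {v : ℝ≥0} (hv : 0 < v) {N : ℕ} (x : Fin N → EuclideanSpace ℝ (Fin d))
    (a : Fin N → ℝ) :
    ∑ i, ∑ j, a i * a j * A.kernel v (x i) (x j) =
      A.outDim / A.mass * ∫ θ, (∑ i, a i * A.act θ (x i)) ^ 2 ∂A.paramLaw v d := by
  have hi : ∀ i j, Integrable (fun θ => A.act θ (x i) * A.act θ (x j)) (A.paramLaw v d) :=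
    fun i j => (A.memLp_act hv (x i)).integrable_mul (A.memLp_act hv (x j))
  have e : ∀ θ : A.Params d, (∑ i, a i * A.act θ (x i)) ^ 2 =
      ∑ i, ∑ j, a i * a j * (A.act θ (x i) * A.act θ (x j)) := by
    intro θ
    rw [sq, Finset.sum_mul_sum]
    exact Finset.sum_congr rfl fun i _ => Finset.sum_congr rfl fun j _ => by ring
  simp only [e]
  rw [integral_finsetSum _ fun i _ => integrable_finsetSum _ fun j _ => (hi i j).const_mul _,
    Finset.mul_sum]
  refine Finset.sum_congr rfl fun i _ => ?_
  rw [integral_finsetSum _ fun j _ => (hi i j).const_mul _, Finset.mul_sum]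
  refine Finset.sum_congr rfl fun j _ => ?_
  rw [integral_const_mul, kernel_eq]
  ring

theorem exists_kernel_self_le {v : ℝ≥0} (hv : 0 < v) :
    ∃ C : ℝ, 0 < C ∧ ∀ (d : ℕ) (x : EuclideanSpace ℝ (Fin d)),
      A.kernel v x x ≤ C * (‖x‖ ^ 2 + 1) := by
  obtain ⟨C, hC0, hC⟩ := A.exists_second_moment_le hv
  have hv' : (0 : ℝ) < v := hv
  have ho : (0 : ℝ) < A.outDim := by exact_mod_cast A.outDim_pos
  have hM := A.mass_pos
  refine ⟨A.outDim / A.mass * (C * v), by positivity, fun d x => ?_⟩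
  have h := (hC d x 0 le_rfl).2
  simp only [tilt_zero, one_mul, sq (A.act _ _)] at h
  rw [preactScale_sq, ← EuclideanSpace.real_norm_sq_eq] at h
  rw [kernel_eq]
  calc _ ≤ A.outDim / A.mass * (C * (v * (‖x‖ ^ 2 + 1))) := by gcongr
    _ = _ := by ring

/-- Lower bound on the kernel form for nearly orthogonal inputs. -/
theorem exists_le_kernel_form {v : ℝ≥0} (hv : 0 < v) {r : ℕ} (hr : 1 ≤ r) :
    ∃ c B : ℝ, 0 < c ∧ 1 ≤ B ∧ ∀ (d N : ℕ) (x : Fin N → EuclideanSpace ℝ (Fin d)) (m e : ℝ),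
      0 ≤ e → (∀ i, m ≤ ‖x i‖ ^ 2) →
      (∀ i j, i ≠ j → B * |preactCorr (ι := Fin d) v (x i) (x j)| ^ r ≤ e) → N * e ≤ 1 / 2 →
      ∀ a : Fin N → ℝ, c * m * ∑ i, a i ^ 2 ≤ ∑ i, ∑ j, a i * a j * A.kernel v (x i) (x j) := by
  obtain ⟨Λ, B, hΛ, hB, hbd⟩ := A.exists_testFun_bounds hv hr
  have hv' : (0 : ℝ) < v := hv
  have ho : (0 : ℝ) < A.outDim := by exact_mod_cast A.outDim_pos
  have hM := A.mass_pos
  refine ⟨A.outDim / A.mass * (v / (8 * B)), B, by positivity, hB,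
    fun d N x m e he hm hcorr hNe a => ?_⟩
  set s : Fin N → ℝ := fun i => preactScale (ι := Fin d) v (x i) with hs
  have hsp : ∀ i, 0 < s i := fun i => preactScale_pos hv _
  -- Dividing by `s i` makes the diagonal pairings at least 1; the coefficients `a i * s i` undo
  -- this, and `s i ^ 2 ≥ v m` supplies the factor `m`.
  have hgram := le_gram_form (μ := A.paramLaw v d)
    (S := fun i θ => (s i)⁻¹ * A.act θ (x i))
    (h := fun i θ => testFun r Λ 1 (A.firstPreact v θ (x i)))
    (fun i => (A.memLp_act hv (x i)).const_mul _)
    (fun i => (memLp_testFun r hr hΛ (by simp)).comp_measurePreserving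
      (A.measurePreserving_firstPreact hv (x i))) hB he
    (fun i => by
      simp only [mul_assoc, integral_const_mul]
      rw [← div_eq_inv_mul, one_le_div (hsp i)]
      exact (hbd d (x i) (x i)).1)
    (fun i j hij => by
      simp only [mul_assoc, integral_const_mul]
      rw [abs_mul, abs_of_pos (inv_pos.mpr (hsp i)), inv_mul_le_iff₀ (hsp i)]
      refine ((hbd d (x i) (x j)).2.1).trans ?_
      rw [mul_comm]
      exact mul_le_mul_of_nonneg_left (hcorr i j hij) (hsp i).le)
    (fun i => by
      refine ((hbd d (x i) (x i)).2.2).trans ?_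
      rw [preactCorr_self hv, abs_one, one_pow, mul_one])
    (fun i j hij => ((hbd d (x i) (x j)).2.2).trans (hcorr i j hij)) hNe (fun i => a i * s i)
  have e1 : ∀ θ : A.Params d, ∑ i, a i * s i * ((s i)⁻¹ * A.act θ (x i)) =
      ∑ i, a i * A.act θ (x i) := fun θ => Finset.sum_congr rfl fun i _ => by
    have := (hsp i).ne'
    field_simp
  simp only [e1] at hgram
  rw [kernel_form A hv, mul_assoc, mul_assoc]
  refine mul_le_mul_of_nonneg_left (le_trans ?_ hgram) (by positivity)
  have h2 : v * (m * ∑ i, a i ^ 2) ≤ ∑ i, (a i * s i) ^ 2 := by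
    rw [Finset.mul_sum, Finset.mul_sum]
    refine Finset.sum_le_sum fun i _ => ?_
    rw [mul_pow, hs, preactScale_sq, ← EuclideanSpace.real_norm_sq_eq]
    have h3 : m ≤ ‖x i‖ ^ 2 + 1 := by linarith [hm i]
    have h4 := mul_le_mul_of_nonneg_left h3 (mul_nonneg hv'.le (sq_nonneg (a i)))
    linarith
  calc _ = v * (m * ∑ i, a i ^ 2) / (8 * B) := by ring
    _ ≤ _ := by gcongr

end ShortcutNet

/-! ### Concentration of Gaussian norms and inner products -/

section Concentration

/-- The standard Gaussian law on `Fin d → ℝ`. -/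
abbrev stdPi (d : ℕ) : Measure (Fin d → ℝ) := Measure.pi fun _ => gaussianReal 0 1

theorem lintegral_stdPi_prod {d : ℕ} {f : Fin d → ℝ → ENNReal} (hf : ∀ i, Measurable (f i)) :
    ∫⁻ y, ∏ i, f i (y i) ∂stdPi d = ∏ i, ∫⁻ t, f i t ∂gaussianReal 0 1 := by
  have h := lintegral_prod_eq_prod_lintegral_of_indepFun (μ := stdPi d) Finset.univ
    (fun i y => f i (y i))
    (iIndepFun_pi (μ := fun _ : Fin d => gaussianReal 0 1) fun i => (hf i).aemeasurable)
    (fun i => (hf i).comp (measurable_pi_apply i))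
  rw [h]
  exact Finset.prod_congr rfl fun i _ =>
    (measurePreserving_eval (fun _ : Fin d => gaussianReal 0 1) i).lintegral_comp (hf i)

theorem lintegral_exp_mul_sq {a : ℝ} (ha : a < 1 / 2) :
    ∫⁻ t, ENNReal.ofReal (Real.exp (a * t ^ 2)) ∂gaussianReal 0 1 =
      ENNReal.ofReal (Real.sqrt (1 - 2 * a))⁻¹ := by
  have hb : 0 < 1 / 2 - a := by linarith
  have hpdf : ∀ t, gaussianPDF 0 1 t * ENNReal.ofReal (Real.exp (a * t ^ 2)) =
      ENNReal.ofReal ((Real.sqrt (2 * Real.pi))⁻¹ * Real.exp (-(1 / 2 - a) * t ^ 2)) := by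
    intro t
    rw [gaussianPDF, ← ENNReal.ofReal_mul (gaussianPDFReal_nonneg _ _ _), gaussianPDFReal, mul_assoc,
      ← Real.exp_add]
    simp only [NNReal.coe_one, mul_one, sub_zero]
    congr 3
    ring
  rw [gaussianReal_of_var_ne_zero 0 one_ne_zero, lintegral_withDensity_eq_lintegral_mul _
    (measurable_gaussianPDF 0 1) (by fun_prop)]
  simp only [Pi.mul_apply, hpdf]
  rw [← ofReal_integral_eq_lintegral_ofReal ((integrable_exp_neg_mul_sq hb).const_mul _)
    (.of_forall fun t => by positivity), integral_const_mul, integral_gaussian]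
  congr 1
  rw [← Real.sqrt_inv, ← Real.sqrt_mul (by positivity), ← Real.sqrt_inv]
  congr 1
  have h2 : 1 - 2 * a ≠ 0 := by linarith
  have h3 : 1 / 2 - a ≠ 0 := hb.ne'
  rw [show 1 / 2 - a = (1 - 2 * a) / 2 by ring]
  field_simp

theorem lintegral_exp_mul_sum_sq (d : ℕ) {a : ℝ} (ha : a < 1 / 2) :
    ∫⁻ y, ENNReal.ofReal (Real.exp (a * ∑ i, y i ^ 2)) ∂stdPi d =
      ENNReal.ofReal (Real.sqrt (1 - 2 * a))⁻¹ ^ d := by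
  have h1 : ∀ y : Fin d → ℝ, ENNReal.ofReal (Real.exp (a * ∑ i, y i ^ 2)) =
      ∏ i, ENNReal.ofReal (Real.exp (a * y i ^ 2)) := fun y => by
    rw [Finset.mul_sum, Real.exp_sum, ENNReal.ofReal_prod_of_nonneg fun i _ => (Real.exp_pos _).le]
  simp only [h1]
  rw [lintegral_stdPi_prod (f := fun _ t => ENNReal.ofReal (Real.exp (a * t ^ 2)))
    fun _ => by fun_prop]
  simp [lintegral_exp_mul_sq ha]

/-- Given the first vector the sum is Gaussian, which leaves the exponential moment of `(ε²/2) ∑ g i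
^ 2`. -/
theorem lintegral_exp_mul_sum_mul (d : ℕ) {ε : ℝ} (hε : ε ^ 2 < 1) :
    ∫⁻ u, ENNReal.ofReal (Real.exp (ε * ∑ i, u.1 i * u.2 i)) ∂(stdPi d).prod (stdPi d) =
      ENNReal.ofReal (Real.sqrt (1 - ε ^ 2))⁻¹ ^ d := by
  have h1D : ∀ s : ℝ, ∫⁻ t, ENNReal.ofReal (Real.exp (s * t)) ∂gaussianReal 0 1 =
      ENNReal.ofReal (Real.exp (s ^ 2 / 2)) := fun s => by
    have h := congrFun (mgf_fun_id_gaussianReal (μ := 0) (v := 1)) s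
    rw [mgf] at h
    rw [← ofReal_integral_eq_lintegral_ofReal (integrable_exp_mul_gaussianReal s)
      (.of_forall fun t => (Real.exp_pos _).le), h]
    simp
  have h1 : ∀ g : Fin d → ℝ, ∫⁻ y, ENNReal.ofReal (Real.exp (ε * ∑ i, g i * y i)) ∂stdPi d =
      ENNReal.ofReal (Real.exp (ε ^ 2 / 2 * ∑ i, g i ^ 2)) := fun g => by
    have e : ∀ y : Fin d → ℝ, ENNReal.ofReal (Real.exp (ε * ∑ i, g i * y i)) =
        ∏ i, ENNReal.ofReal (Real.exp (ε * g i * y i)) := fun y => by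
      rw [Finset.mul_sum, Real.exp_sum,
        ENNReal.ofReal_prod_of_nonneg fun i _ => (Real.exp_pos _).le]
      exact Finset.prod_congr rfl fun i _ => by rw [mul_assoc]
    simp only [e]
    rw [lintegral_stdPi_prod (f := fun i t => ENNReal.ofReal (Real.exp (ε * g i * t)))
      fun _ => by fun_prop]
    simp only [h1D]
    rw [← ENNReal.ofReal_prod_of_nonneg fun i _ => (Real.exp_pos _).le, ← Real.exp_sum,
      Finset.mul_sum]
    congr 2
    exact Finset.sum_congr rfl fun i _ => by ring
  rw [lintegral_prod _ (by fun_prop)]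
  simp only [h1]
  rw [lintegral_exp_mul_sum_sq d (by linarith)]
  congr 4
  ring

theorem measure_ge_le_of_lintegral_exp {Ω : Type*} [MeasurableSpace Ω] {μ : Measure Ω} {f : Ω → ℝ}
    (hf : Measurable f) {b : ℝ} {K : ENNReal}
    (hK : ∫⁻ ω, ENNReal.ofReal (Real.exp (f ω)) ∂μ ≤ K) :
    μ {ω | b ≤ f ω} ≤ ENNReal.ofReal (Real.exp (-b)) * K := by
  have h := (mul_meas_ge_le_lintegral (μ := μ) (f := fun ω => ENNReal.ofReal (Real.exp (f ω)))
    (by fun_prop) (ENNReal.ofReal (Real.exp b))).trans hK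
  have hset : {ω | b ≤ f ω} ⊆
      {ω | ENNReal.ofReal (Real.exp b) ≤ ENNReal.ofReal (Real.exp (f ω))} := fun ω hω =>
    ENNReal.ofReal_le_ofReal (Real.exp_le_exp.mpr hω)
  calc _ ≤ μ {ω | ENNReal.ofReal (Real.exp b) ≤ ENNReal.ofReal (Real.exp (f ω))} :=
        measure_mono hset
    _ = ENNReal.ofReal (Real.exp (-b)) * (ENNReal.ofReal (Real.exp b) *
          μ {ω | ENNReal.ofReal (Real.exp b) ≤ ENNReal.ofReal (Real.exp (f ω))}) := by
        rw [← mul_assoc, ← ENNReal.ofReal_mul (Real.exp_pos _).le, ← Real.exp_add]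
        simp
    _ ≤ _ := by gcongr

/-- This is `1 + t ≤ exp t` at `t = u / (1 - u)`, turning the exact moment generating functions into
Chernoff exponents. -/
theorem inv_sqrt_le_exp {u : ℝ} (hu : u < 1) :
    (Real.sqrt (1 - u))⁻¹ ≤ Real.exp (u / (1 - u) / 2) := by
  have h1 : 0 < 1 - u := by linarith
  have h2 : (1 - u)⁻¹ ≤ Real.exp (u / (1 - u)) := by
    have := Real.add_one_le_exp (u / (1 - u))
    have e : u / (1 - u) + 1 = (1 - u)⁻¹ := by field_simp; ring
    linarith
  rw [← Real.sqrt_inv, Real.sqrt_le_left (Real.exp_pos _).le, ← Real.exp_nat_mul]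
  convert h2 using 2
  push_cast; ring

theorem measure_norm_upper (d : ℕ) :
    stdPi d {y | 2 * (d : ℝ) ≤ ∑ i, y i ^ 2} ≤ ENNReal.ofReal (Real.exp (-(1 / 24 * (d : ℝ)))) := by
  have h := measure_ge_le_of_lintegral_exp (μ := stdPi d) (b := 1 / 8 * (2 * d))
    (f := fun y => 1 / 8 * ∑ i, y i ^ 2) (by fun_prop)
    (lintegral_exp_mul_sum_sq d (a := 1 / 8) (by norm_num)).le
  refine (measure_mono fun y hy => ?_).trans (h.trans ?_)
  · simp only [Set.mem_ofPred_eq] at hy ⊢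
    linarith
  · have h1 := inv_sqrt_le_exp (u := 2 * (1 / 8)) (by norm_num)
    rw [← ENNReal.ofReal_pow (by positivity), ← ENNReal.ofReal_mul (Real.exp_pos _).le]
    refine ENNReal.ofReal_le_ofReal ?_
    calc _ ≤ Real.exp (-(1 / 8 * (2 * d))) * Real.exp (2 * (1 / 8) / (1 - 2 * (1 / 8)) / 2) ^ d := by
          gcongr
      _ ≤ _ := by
          rw [← Real.exp_nat_mul, ← Real.exp_add]
          refine Real.exp_le_exp.mpr ?_
          have : (0 : ℝ) ≤ d := Nat.cast_nonneg d
          norm_num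
          linarith

theorem measure_norm_lower (d : ℕ) :
    stdPi d {y | ∑ i, y i ^ 2 ≤ (d : ℝ) / 2} ≤
      ENNReal.ofReal (Real.exp (-(1 / 24 * (d : ℝ)))) := by
  -- With `a = -1/4` the exponent per dimension is `1/8 - 1/6 = -1/24`, the smaller of the two
  -- rates; `a = 1/8` in the upper tail gives `-1/12`.
  have h := measure_ge_le_of_lintegral_exp (μ := stdPi d) (b := -(1 / 4) * (d / 2))
    (f := fun y => -(1 / 4) * ∑ i, y i ^ 2) (by fun_prop)
    (lintegral_exp_mul_sum_sq d (a := -(1 / 4)) (by norm_num)).le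
  refine (measure_mono fun y hy => ?_).trans (h.trans ?_)
  · simp only [Set.mem_ofPred_eq] at hy ⊢
    linarith
  · have h1 := inv_sqrt_le_exp (u := 2 * -(1 / 4)) (by norm_num)
    rw [← ENNReal.ofReal_pow (by positivity), ← ENNReal.ofReal_mul (Real.exp_pos _).le]
    refine ENNReal.ofReal_le_ofReal ?_
    calc _ ≤ Real.exp (-(-(1 / 4) * (d / 2))) *
          Real.exp (2 * -(1 / 4) / (1 - 2 * -(1 / 4)) / 2) ^ d := by
          gcongr
      _ ≤ _ := by
          rw [← Real.exp_nat_mul, ← Real.exp_add]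
          refine Real.exp_le_exp.mpr ?_
          have : (0 : ℝ) ≤ d := Nat.cast_nonneg d
          norm_num
          linarith

/-- Chernoff at parameter `ε`: the exponent is `-ε² d + ε² d / (2 (1 - ε²))`, and `ε² ≤ 1/4` makes
the second term at most `2 ε² d / 3`. The sign `s` serves both tails. -/
theorem measure_inner_ge (d : ℕ) {ε s : ℝ} (hε : ε ^ 2 ≤ 1 / 4) (hs : s ^ 2 = 1) :
    (stdPi d).prod (stdPi d) {u | ε * d ≤ s * ∑ i, u.1 i * u.2 i ∧ 0 ≤ ε} ≤
      ENNReal.ofReal (Real.exp (-(ε ^ 2 / 3 * (d : ℝ)))) := by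
  have hεs : (ε * s) ^ 2 = ε ^ 2 := by rw [mul_pow, hs, mul_one]
  have h := measure_ge_le_of_lintegral_exp (μ := (stdPi d).prod (stdPi d)) (b := ε * (ε * d))
    (f := fun u => (ε * s) * ∑ i, u.1 i * u.2 i) (by fun_prop)
    (lintegral_exp_mul_sum_mul d (ε := ε * s) (by rw [hεs]; linarith)).le
  refine (measure_mono fun u hu => ?_).trans (h.trans ?_)
  · obtain ⟨h1, h2⟩ := hu
    have := mul_le_mul_of_nonneg_left h1 h2
    simp only [Set.mem_ofPred_eq]
    linarith
  · have h1 := inv_sqrt_le_exp (u := ε ^ 2) (by linarith)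
    rw [hεs, ← ENNReal.ofReal_pow (by positivity), ← ENNReal.ofReal_mul (Real.exp_pos _).le]
    refine ENNReal.ofReal_le_ofReal ?_
    calc _ ≤ Real.exp (-(ε * (ε * d))) * Real.exp (ε ^ 2 / (1 - ε ^ 2) / 2) ^ d := by
          gcongr
      _ ≤ _ := by
          rw [← Real.exp_nat_mul, ← Real.exp_add]
          refine Real.exp_le_exp.mpr ?_
          have hd : (0 : ℝ) ≤ d := Nat.cast_nonneg d
          have h3 : ε ^ 2 / (1 - ε ^ 2) ≤ ε ^ 2 * (4 / 3) := by
            rw [div_le_iff₀ (by linarith)]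
            nlinarith [sq_nonneg ε]
          have h4 := mul_le_mul_of_nonneg_left h3 hd
          nlinarith

/-- The map carrying the standard Gaussian to `N(0, η² I_d)`. -/
def scaleMap (η : ℝ) (d : ℕ) (y : Fin d → ℝ) : EuclideanSpace ℝ (Fin d) := η • WithLp.toLp 2 y

theorem measurable_scaleMap (η : ℝ) (d : ℕ) : Measurable (scaleMap η d) := by
  unfold scaleMap
  have : Measurable fun y : Fin d → ℝ => (WithLp.toLp 2 y : EuclideanSpace ℝ (Fin d)) :=
    WithLp.measurable_toLp 2 _
  fun_prop

theorem map_scaleMap (η : ℝ) (d : ℕ) : (stdPi d).map (scaleMap η d) = gaussianInput η d := by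
  rw [gaussianInput, ← map_pi_eq_stdGaussian, Measure.map_map (by fun_prop)
    (WithLp.measurable_toLp 2 _)]
  rfl

theorem norm_scaleMap_sq (η : ℝ) (d : ℕ) (y : Fin d → ℝ) :
    ‖scaleMap η d y‖ ^ 2 = η ^ 2 * ∑ i, y i ^ 2 := by
  rw [EuclideanSpace.real_norm_sq_eq, Finset.mul_sum]
  exact Finset.sum_congr rfl fun i _ => by simp [scaleMap, mul_pow]

theorem inner_scaleMap (η : ℝ) (d : ℕ) (y y' : Fin d → ℝ) :
    inner ℝ (scaleMap η d y) (scaleMap η d y') = η ^ 2 * ∑ i, y i * y' i := by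
  rw [PiLp.inner_apply, Finset.mul_sum]
  exact Finset.sum_congr rfl fun i _ => by simp [scaleMap]; ring

variable {Ω : Type*} [MeasurableSpace Ω] {P : Measure Ω} {η : ℝ} {d : ℕ}
  {X Y : Ω → EuclideanSpace ℝ (Fin d)}

theorem measure_norm_gaussianInput (hη : η ≠ 0) (hX : HasLaw X (gaussianInput η d) P) :
    P {ω | ¬ (η ^ 2 * (d / 2) ≤ ‖X ω‖ ^ 2 ∧ ‖X ω‖ ^ 2 ≤ η ^ 2 * (2 * d))} ≤
      ENNReal.ofReal (2 * Real.exp (-(1 / 24 * (d : ℝ)))) := by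
  have hη2 : 0 < η ^ 2 := by positivity
  have hm : MeasurableSet {x : EuclideanSpace ℝ (Fin d) |
      ¬ (η ^ 2 * (d / 2) ≤ ‖x‖ ^ 2 ∧ ‖x‖ ^ 2 ≤ η ^ 2 * (2 * d))} := by
    have h1 : MeasurableSet {x : EuclideanSpace ℝ (Fin d) | η ^ 2 * (d / 2) ≤ ‖x‖ ^ 2} :=
      measurableSet_le (by fun_prop) (by fun_prop)
    have h2 : MeasurableSet {x : EuclideanSpace ℝ (Fin d) | ‖x‖ ^ 2 ≤ η ^ 2 * (2 * d)} :=
      measurableSet_le (by fun_prop) (by fun_prop)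
    exact (h1.inter h2).compl
  rw [hX.measure_eq hm, ← map_scaleMap, Measure.map_apply (measurable_scaleMap η d) hm]
  refine (measure_mono (t := {y | 2 * (d : ℝ) ≤ ∑ i, y i ^ 2} ∪
    {y | ∑ i, y i ^ 2 ≤ (d : ℝ) / 2}) fun y hy => ?_).trans ?_
  · simp only [Set.mem_preimage, Set.mem_ofPred_eq, norm_scaleMap_sq, not_and_or, not_le] at hy
    rcases hy with hy | hy
    · exact Or.inr (lt_of_mul_lt_mul_left hy hη2.le).le
    · exact Or.inl (lt_of_mul_lt_mul_left hy hη2.le).le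
  · refine (measure_union_le _ _).trans ((add_le_add (measure_norm_upper d)
      (measure_norm_lower d)).trans ?_)
    rw [← ENNReal.ofReal_add (Real.exp_pos _).le (Real.exp_pos _).le, ← two_mul]

theorem measure_inner_gaussianInput [IsProbabilityMeasure P] (hη : η ≠ 0)
    (hX : HasLaw X (gaussianInput η d) P)
    (hY : HasLaw Y (gaussianInput η d) P) (hXY : IndepFun X Y P) {ε s : ℝ} (hε0 : 0 ≤ ε)
    (hε : ε ^ 2 ≤ 1 / 4) (hs : s ^ 2 = 1) :
    P {ω | ε * (η ^ 2 * d) < s * inner ℝ (X ω) (Y ω)} ≤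
      ENNReal.ofReal (Real.exp (-(ε ^ 2 / 3 * (d : ℝ)))) := by
  have hη2 : 0 < η ^ 2 := by positivity
  have hlaw := hXY.map_prod_eq_prod_map_map hX.aemeasurable hY.aemeasurable
  rw [hX.map_eq, hY.map_eq, ← map_scaleMap, Measure.map_prod_map _ _ (measurable_scaleMap η d)
    (measurable_scaleMap η d)] at hlaw
  have hm : MeasurableSet {u : EuclideanSpace ℝ (Fin d) × EuclideanSpace ℝ (Fin d) |
      ε * (η ^ 2 * d) < s * inner ℝ u.1 u.2} :=
    measurableSet_lt (by fun_prop) (by fun_prop)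
  have h1 : P {ω | ε * (η ^ 2 * d) < s * inner ℝ (X ω) (Y ω)} =
      (stdPi d).prod (stdPi d) (Prod.map (scaleMap η d) (scaleMap η d) ⁻¹'
        {u | ε * (η ^ 2 * d) < s * inner ℝ u.1 u.2}) := by
    rw [← Measure.map_apply ((measurable_scaleMap η d).prodMap (measurable_scaleMap η d)) hm,
      ← hlaw, Measure.map_apply_of_aemeasurable (hX.aemeasurable.prodMk hY.aemeasurable) hm]
    rfl
  rw [h1]
  refine (measure_mono fun u hu => ?_).trans (measure_inner_ge d hε hs)
  simp only [Set.mem_preimage, Set.mem_ofPred_eq, Prod.map_fst, Prod.map_snd,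
    inner_scaleMap] at hu ⊢
  refine ⟨(lt_of_mul_lt_mul_left (a := η ^ 2) ?_ hη2.le).le, hε0⟩
  linarith

end Concentration

/-! ### From the kernel form to the smallest eigenvalue -/

/-- Testing the form on an eigenvector gives the lower bound; the upper one holds because the
smallest eigenvalue is at most their average, the normalized trace. -/
theorem exists_isSmallestEigenvalue {N : ℕ} (hN : 1 ≤ N) {M : Matrix (Fin N) (Fin N) ℝ}
    (hM : ∀ i j, M i j = M j i) {α β : ℝ}
    (hα : ∀ a : Fin N → ℝ, α * ∑ i, a i ^ 2 ≤ ∑ i, ∑ j, a i * a j * M i j)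
    (hβ : ∀ i, M i i ≤ β) : ∃ t, IsSmallestEigenvalue M t ∧ α ≤ t ∧ t ≤ β := by
  have hH : M.IsHermitian := by
    ext i j
    simpa using hM j i
  have : Nonempty (Fin N) := ⟨⟨0, hN⟩⟩
  have hset : {s : ℝ | Module.End.HasEigenvalue (Matrix.toLin' M) s} =
      Set.range hH.eigenvalues := by
    rw [← hH.spectrum_real_eq_range_eigenvalues, ← Matrix.spectrum_toLin']
    ext s
    exact Module.End.hasEigenvalue_iff_mem_spectrum
  obtain ⟨k, hk⟩ := Finite.exists_min hH.eigenvalues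
  have hev : Module.End.HasEigenvalue (Matrix.toLin' M) (hH.eigenvalues k) := by
    have : hH.eigenvalues k ∈ {s : ℝ | Module.End.HasEigenvalue (Matrix.toLin' M) s} := by
      rw [hset]; exact ⟨k, rfl⟩
    exact this
  refine ⟨hH.eigenvalues k, ⟨hev, ?_⟩, ?_, ?_⟩
  · rw [hset]
    rintro _ ⟨j, rfl⟩
    exact hk j
  · obtain ⟨a, ha, ha0⟩ := hev.exists_hasEigenvector
    rw [Module.End.mem_eigenspace_iff, Matrix.toLin'_apply] at ha
    have h1 : ∑ i, ∑ j, a i * a j * M i j = hH.eigenvalues k * ∑ i, a i ^ 2 := by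
      rw [Finset.mul_sum]
      refine Finset.sum_congr rfl fun i _ => ?_
      have := congrFun ha i
      simp only [Matrix.mulVec, dotProduct, Pi.smul_apply, smul_eq_mul] at this
      calc _ = a i * ∑ j, M i j * a j := by
            rw [Finset.mul_sum]
            exact Finset.sum_congr rfl fun j _ => by ring
        _ = _ := by rw [this]; ring
    have h2 : 0 < ∑ i, a i ^ 2 := by
      obtain ⟨i, hi⟩ := Function.ne_iff.mp ha0
      exact Finset.sum_pos' (fun i _ => sq_nonneg _) ⟨i, Finset.mem_univ _, by
        have : a i ≠ 0 := hi
        positivity⟩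
    have h3 := hα a
    rw [h1] at h3
    exact le_of_mul_le_mul_right h3 h2
  · have htr := hH.trace_eq_sum_eigenvalues
    have h1 : N * hH.eigenvalues k ≤ ∑ i, hH.eigenvalues i := by
      have := Finset.card_nsmul_le_sum Finset.univ hH.eigenvalues (hH.eigenvalues k)
        fun i _ => hk i
      simpa using this
    have h2 : M.trace ≤ N * β := by
      have := Finset.sum_le_card_nsmul Finset.univ (fun i => M i i) β fun i _ => hβ i
      simpa [Matrix.trace] using this
    have h3 : M.trace = ∑ i, hH.eigenvalues i := by simpa using htr
    have hN' : (0 : ℝ) < N := by exact_mod_cast hN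
    rw [← h3] at h1
    exact le_of_mul_le_mul_left (h1.trans h2) hN'

/-- For `η = 0` the second moments vanish and cannot be of order `d`. -/
theorem WellScaled.eta_ne_zero {η : ℝ} (hη : WellScaled (gaussianInput η)) : η ≠ 0 := by
  rintro rfl
  have h := hη.second.symm.isBigO
  have h0 : ∀ d : ℕ, ∫ x, ‖x‖ ^ 2 ∂gaussianInput 0 d = 0 := by
    intro d
    rw [gaussianInput, integral_map (by fun_prop) (by fun_prop)]
    simp
  simp only [h0] at h
  obtain ⟨d, hd, hd1⟩ := ((Asymptotics.isBigO_zero_right_iff.mp h).and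
    (Filter.eventually_ge_atTop 1)).exists
  simp only [Pi.zero_apply, Nat.cast_eq_zero] at hd
  omega

theorem preactCorr_le_of_inner {v : ℝ≥0} (hv : 0 < v) {d : ℕ} (x y : EuclideanSpace ℝ (Fin d))
    {m t : ℝ} (hm : 0 < m) (hx : m ≤ ‖x‖ ^ 2) (hy : m ≤ ‖y‖ ^ 2) (hxy : |inner ℝ x y| ≤ t) :
    |preactCorr (ι := Fin d) v x y| ≤ (t + 1) / m := by
  have hv' : (0 : ℝ) < v := hv
  have hin : ∑ q, x q * y q = inner ℝ x y := by
    rw [PiLp.inner_apply]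
    exact Finset.sum_congr rfl fun q _ => by simp [mul_comm]
  have hs : ∀ z : EuclideanSpace ℝ (Fin d), m ≤ ‖z‖ ^ 2 →
      Real.sqrt (v * m) ≤ preactScale (ι := Fin d) v z := fun z hz => by
    rw [preactScale, ← EuclideanSpace.real_norm_sq_eq]
    exact Real.sqrt_le_sqrt (mul_le_mul_of_nonneg_left (by linarith) hv'.le)
  have hpos : 0 < Real.sqrt (v * m) := Real.sqrt_pos.mpr (by positivity)
  have hprod : v * m ≤ preactScale (ι := Fin d) v x * preactScale (ι := Fin d) v y := by
    rw [← Real.mul_self_sqrt (by positivity : 0 ≤ v * m)]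
    exact mul_le_mul (hs x hx) (hs y hy) hpos.le (preactScale_nonneg _ _)
  have ht : 0 ≤ t := (abs_nonneg _).trans hxy
  rw [preactCorr, hin, abs_div, abs_mul, abs_of_pos hv',
    abs_of_pos (lt_of_lt_of_le (by positivity) hprod)]
  calc _ ≤ v * (t + 1) / (v * m) := by
        gcongr
        refine (abs_add_le _ _).trans ?_
        rw [abs_one]
        linarith
    _ = _ := by field_simp

theorem ShortcutNet.exists_smallestEigenvalue_bounds (A : ShortcutNet) {v : ℝ≥0} (hv : 0 < v)
    {η : ℝ} (hη : η ≠ 0) {r : ℕ} (hr : 1 ≤ r) :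
    ∃ c₁ c₂ B : ℝ, 0 < c₁ ∧ 0 < c₂ ∧ 1 ≤ B ∧ ∀ (d N : ℕ), 1 ≤ d → 1 ≤ N →
      ∀ (x : Fin N → EuclideanSpace ℝ (Fin d)) (ε : ℝ),
      (∀ i, η ^ 2 * (d / 2) ≤ ‖x i‖ ^ 2 ∧ ‖x i‖ ^ 2 ≤ η ^ 2 * (2 * d)) →
      (∀ i j, i ≠ j → |inner ℝ (x i) (x j)| ≤ ε * (η ^ 2 * d)) →
      2 / (η ^ 2 * d) ≤ ε → N * (B * (3 * ε) ^ r) ≤ 1 / 2 →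
      ∃ t, IsSmallestEigenvalue (A.kernelMatrix v x) t ∧ c₁ * d ≤ t ∧ t ≤ c₂ * d := by
  obtain ⟨c, B, hc, hB, hlow⟩ := A.exists_le_kernel_form hv hr
  obtain ⟨C, hC, hup⟩ := A.exists_kernel_self_le hv
  have hη2 : 0 < η ^ 2 := by positivity
  refine ⟨c * (η ^ 2 / 2), C * (2 * η ^ 2 + 1), B, by positivity, by positivity, hB,
    fun d N hd hN x ε hnorm hinner hεd hNε => ?_⟩
  have hd' : (1 : ℝ) ≤ d := by exact_mod_cast hd
  have hε : 0 ≤ ε := le_trans (by positivity) hεd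
  have hm : 0 < η ^ 2 * ((d : ℝ) / 2) := by positivity
  have hcorr : ∀ i j, i ≠ j → B * |preactCorr (ι := Fin d) v (x i) (x j)| ^ r ≤
      B * (3 * ε) ^ r := fun i j hij => by
    have h1 := preactCorr_le_of_inner hv (x i) (x j) hm (hnorm i).1 (hnorm j).1 (hinner i j hij)
    -- A squared norm may be half of `η² d`, which gives `2ε`; the bias term `2 / (η² d)` is
    -- absorbed by one more `ε`.
    have h2 : (ε * (η ^ 2 * d) + 1) / (η ^ 2 * ((d : ℝ) / 2)) ≤ 3 * ε := by
      have : (ε * (η ^ 2 * d) + 1) / (η ^ 2 * ((d : ℝ) / 2)) = 2 * ε + 2 / (η ^ 2 * d) := by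
        field_simp
      rw [this]; linarith
    have := h1.trans h2
    gcongr
  obtain ⟨t, ht, h1, h2⟩ := exists_isSmallestEigenvalue hN (M := A.kernelMatrix v x)
    (α := c * (η ^ 2 * (d / 2))) (β := C * (2 * η ^ 2 + 1) * d)
    (fun i j => A.kernel_comm v _ _)
    (hlow d N x _ _ (by positivity) (fun i => (hnorm i).1) hcorr hNε)
    (fun i => by
      refine (hup d (x i)).trans ?_
      rw [mul_assoc]
      refine mul_le_mul_of_nonneg_left ?_ hC.le
      nlinarith [(hnorm i).2])
  exact ⟨t, ht, by linarith, h2⟩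

theorem measure_bad_gaussianInput {η : ℝ} (hη : η ≠ 0) {d N : ℕ} {Ω : Type*} [MeasurableSpace Ω]
    {P : Measure Ω} [IsProbabilityMeasure P] {x : Fin N → Ω → EuclideanSpace ℝ (Fin d)}
    (hx : ∀ i, HasLaw (x i) (gaussianInput η d) P) (hind : iIndepFun x P) {ε : ℝ} (hε0 : 0 ≤ ε)
    (hε : ε ^ 2 ≤ 1 / 4) :
    P {ω | ¬ ((∀ i, η ^ 2 * (d / 2) ≤ ‖x i ω‖ ^ 2 ∧ ‖x i ω‖ ^ 2 ≤ η ^ 2 * (2 * d)) ∧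
      ∀ i j, i ≠ j → |inner ℝ (x i ω) (x j ω)| ≤ ε * (η ^ 2 * d))} ≤
      ENNReal.ofReal (N * (2 * Real.exp (-(1 / 24 * (d : ℝ)))) +
        N ^ 2 * Real.exp (-(ε ^ 2 / 3 * (d : ℝ)))) := by
  set F : Fin N → Set Ω := fun i =>
    {ω | ¬ (η ^ 2 * (d / 2) ≤ ‖x i ω‖ ^ 2 ∧ ‖x i ω‖ ^ 2 ≤ η ^ 2 * (2 * d))} with hF
  -- The two signs for an unordered pair are shared between `(i, j)` and `(j, i)`, so that `N²`
  -- one-sided events control absolute values without a factor 2.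
  set E : Fin N → Fin N → Set Ω := fun i j =>
    {ω | i ≠ j ∧ ε * (η ^ 2 * d) < (if i < j then 1 else -1) * inner ℝ (x i ω) (x j ω)} with hE
  have hsub : {ω | ¬ ((∀ i, η ^ 2 * (d / 2) ≤ ‖x i ω‖ ^ 2 ∧ ‖x i ω‖ ^ 2 ≤ η ^ 2 * (2 * d)) ∧
      ∀ i j, i ≠ j → |inner ℝ (x i ω) (x j ω)| ≤ ε * (η ^ 2 * d))} ⊆
      (⋃ i, F i) ∪ ⋃ i, ⋃ j, E i j := by
    intro ω hω
    by_contra hcon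
    simp only [Set.mem_union, Set.mem_iUnion, not_or, not_exists] at hcon
    obtain ⟨h1, h2⟩ := hcon
    refine hω ⟨fun i => not_not.mp (h1 i), fun i j hij => ?_⟩
    have h3 : ∀ i j, i ≠ j →
        (if i < j then (1 : ℝ) else -1) * inner ℝ (x i ω) (x j ω) ≤ ε * (η ^ 2 * d) :=
      fun i j hij => not_lt.mp fun h => h2 i j ⟨hij, h⟩
    have h4 := h3 i j hij
    have h5 := h3 j i hij.symm
    rw [real_inner_comm] at h5
    rw [abs_le]
    rcases lt_or_gt_of_ne hij with h | h
    · rw [if_pos h] at h4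
      rw [if_neg h.asymm] at h5
      constructor <;> linarith
    · rw [if_neg h.asymm] at h4
      rw [if_pos h] at h5
      constructor <;> linarith
  have hEle : ∀ i j, P (E i j) ≤ ENNReal.ofReal (Real.exp (-(ε ^ 2 / 3 * (d : ℝ)))) := by
    intro i j
    by_cases hij : i = j
    · have : E i j = ∅ := by
        ext ω
        simp [hE, hij]
      rw [this]; simp
    · refine (measure_mono fun ω hω => hω.2).trans
        (measure_inner_gaussianInput hη (hx i) (hx j) (hind.indepFun hij) hε0 hε ?_)
      split_ifs <;> norm_num
  refine (measure_mono hsub).trans ((measure_union_le _ _).trans ?_)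
  rw [ENNReal.ofReal_add (by positivity) (by positivity)]
  refine add_le_add ?_ ?_
  · refine (measure_iUnion_fintype_le P _).trans ((Finset.sum_le_sum fun i _ =>
      measure_norm_gaussianInput hη (hx i)).trans ?_)
    rw [Finset.sum_const, Finset.card_univ, Fintype.card_fin, nsmul_eq_mul,
      ENNReal.ofReal_mul (Nat.cast_nonneg _), ENNReal.ofReal_natCast]
  · refine (measure_iUnion_fintype_le P _).trans ((Finset.sum_le_sum fun i _ =>
      (measure_iUnion_fintype_le P _).trans (Finset.sum_le_sum fun j _ => hEle i j)).trans ?_)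
    simp only [Finset.sum_const, Finset.card_univ, Fintype.card_fin, nsmul_eq_mul]
    rw [ENNReal.ofReal_mul (by positivity), ENNReal.ofReal_pow (Nat.cast_nonneg _),
      ENNReal.ofReal_natCast, sq (N : ENNReal), mul_assoc]

end DepthNNGP

end

/-! ### Choice of scales and conclusion -/

theorem theorem3 (η : ℝ) (hη : DepthNNGP.WellScaled (DepthNNGP.gaussianInput η))
    (A : DepthNNGP.ShortcutNet) (v : ℝ≥0) (hv : 0 < v) (r : ℕ) (hr : 2 ≤ r) :
    ∃ c₁ > (0 : ℝ), ∃ c₂ > (0 : ℝ), ∃ c₃ > (0 : ℝ), ∃ c₄ > (0 : ℝ), ∃ d₀ : ℕ,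
      ∀ d : ℕ, d₀ ≤ d → ∀ N : ℕ, 1 ≤ N →
      ∀ (Ω : Type*) [MeasurableSpace Ω] (P : Measure Ω) [IsProbabilityMeasure P]
        (x : Fin N → Ω → EuclideanSpace ℝ (Fin d)),
        (∀ i, HasLaw (x i) (DepthNNGP.gaussianInput η d) P) → iIndepFun x P →
        1 - ((N : ℝ) * Real.exp (-(c₃ * (d : ℝ))) +
            (N : ℝ) ^ 2 *
              Real.exp (-(c₄ * ((d : ℝ) * (N : ℝ) ^ (-2 / ((r : ℝ) - 0.5)))))) ≤
          P.real {ω | ∃ t : ℝ,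
            DepthNNGP.IsSmallestEigenvalue (A.kernelMatrix v fun i => x i ω) t ∧
              c₁ * (d : ℝ) ≤ t ∧ t ≤ c₂ * (d : ℝ)} := by
  have hη0 := hη.eta_ne_zero
  have hη2 : 0 < η ^ 2 := by positivity
  obtain ⟨c₁, c₂, B, hc₁, hc₂, hB, hmain⟩ :=
    A.exists_smallestEigenvalue_bounds hv hη0 (r := r) (by omega)
  -- Makes `B * (3 ε₀) = 1/2`, so `N * (B * (3 ε₀ u)^r) ≤ 1/2` as soon as `N u^r ≤ 1`; also `ε₀ ≤
  -- 1/6` keeps `ε² ≤ 1/4`.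
  set ε₀ : ℝ := 1 / (6 * B) with hε₀
  have hε₀pos : 0 < ε₀ := by positivity
  have hε₀le : ε₀ ≤ 1 / 6 := by
    rw [hε₀]
    exact one_div_le_one_div_of_le (by norm_num) (by linarith)
  obtain ⟨d₁, hd₁⟩ := exists_nat_ge (4 / (ε₀ ^ 2 * η ^ 4))
  -- Halving the rate `1/24` absorbs the factor 2 from the two norm tails once `d ≥ 48`; `d₁` serves
  -- to absorb the bias in the correlations.
  refine ⟨c₁, hc₁, c₂, hc₂, 1 / 48, by norm_num, ε₀ ^ 2 / 3, by positivity, max 48 d₁,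
    fun d hd N hN Ω _ P _ x hx hind => ?_⟩
  have hd48 : (48 : ℝ) ≤ d := by exact_mod_cast (le_max_left _ _).trans hd
  have hdd₁ : 4 / (ε₀ ^ 2 * η ^ 4) ≤ d := hd₁.trans (by exact_mod_cast (le_max_right _ _).trans hd)
  have hN1 : (1 : ℝ) ≤ N := by exact_mod_cast hN
  have hr2 : (2 : ℝ) ≤ r := by exact_mod_cast hr
  have hrpos : (0 : ℝ) < (r : ℝ) - 0.5 := by norm_num; linarith
  set u : ℝ := (N : ℝ) ^ (-1 / ((r : ℝ) - 0.5)) with hu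
  have hupos : 0 < u := Real.rpow_pos_of_pos (by linarith) _
  have hu1 : u ≤ 1 := Real.rpow_le_one_of_one_le_of_nonpos hN1
    (div_nonpos_of_nonpos_of_nonneg (by norm_num) hrpos.le)
  have hu2 : (N : ℝ) ^ (-2 / ((r : ℝ) - 0.5)) = u ^ 2 := by
    rw [hu, ← Real.rpow_natCast, ← Real.rpow_mul (by linarith)]
    congr 1
    push_cast
    ring
  rw [hu2]
  -- If `d u² < 1`, then `N ≥ 2` and `δ ≥ N² exp(-1) ≥ 4/3`, so the claim is vacuous. Otherwise `d
  -- u² ≥ 1` gives `ε η² d ≥ 2`, so `ε` dominates the bias.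
  by_cases htriv : (d : ℝ) * u ^ 2 < 1
  · refine le_trans ?_ measureReal_nonneg
    have hN2 : (2 : ℝ) ≤ N := by
      by_contra hlt
      have : N = 1 := by
        have : N < 2 := by exact_mod_cast not_le.mp hlt
        omega
      rw [hu, this] at htriv
      simp only [Nat.cast_one, Real.one_rpow, one_pow, mul_one] at htriv
      linarith
    have h1 : Real.exp (-1) ≤ Real.exp (-(ε₀ ^ 2 / 3 * (d * u ^ 2))) := by
      refine Real.exp_le_exp.mpr ?_
      have : 0 ≤ (d : ℝ) * u ^ 2 := by positivity
      nlinarith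
    have h2 : 1 / 3 ≤ Real.exp (-1) := by
      rw [Real.exp_neg, one_div]
      exact inv_anti₀ (Real.exp_pos _) (by linarith [Real.exp_one_lt_d9])
    have h3 : 0 ≤ (N : ℝ) * Real.exp (-(1 / 48 * (d : ℝ))) := by positivity
    nlinarith [mul_le_mul hN2 hN2 (by norm_num) (by linarith)]
  · push Not at htriv
    set ε : ℝ := ε₀ * u with hε
    have hεle : ε ≤ 1 / 6 := by nlinarith
    have hεpos : 0 < ε := by positivity
    have hbad := DepthNNGP.measure_bad_gaussianInput hη0 hx hind hεpos.le (by nlinarith)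
    have hεd : 2 / (η ^ 2 * d) ≤ ε := by
      rw [div_le_iff₀ (by positivity)]
      refine (sq_le_sq₀ (by norm_num) (by positivity)).mp ?_
      have h4 : 4 ≤ d * (ε₀ ^ 2 * η ^ 4) := by
        rwa [div_le_iff₀ (by positivity)] at hdd₁
      have : (ε * (η ^ 2 * d)) ^ 2 = d * (ε₀ ^ 2 * η ^ 4) * (d * u ^ 2) := by rw [hε]; ring
      rw [this]
      nlinarith
    -- The exponent of `N` is `1 - r / (r - 1/2) < 0`.
    have hNu : N * u ^ r ≤ 1 := by
      have h1 : u ^ r = (N : ℝ) ^ (-1 / ((r : ℝ) - 0.5) * r) := by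
        rw [hu, ← Real.rpow_natCast, ← Real.rpow_mul (by linarith)]
      have h2 : (N : ℝ) ^ (-1 / ((r : ℝ) - 0.5) * r) ≤ (N : ℝ) ^ (-1 : ℝ) := by
        refine Real.rpow_le_rpow_of_exponent_le hN1 ?_
        rw [div_mul_eq_mul_div, div_le_iff₀ hrpos]
        norm_num
      rw [h1]
      calc _ ≤ (N : ℝ) * (N : ℝ) ^ (-1 : ℝ) := by gcongr
        _ = 1 := by rw [Real.rpow_neg_one, mul_inv_cancel₀ (by linarith)]
    have hNε : N * (B * (3 * ε) ^ r) ≤ 1 / 2 := by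
      have h1 : (3 * ε₀) ^ r ≤ 3 * ε₀ := pow_le_of_le_one (by positivity) (by linarith) (by omega)
      have h2 : B * (3 * ε₀) = 1 / 2 := by rw [hε₀]; field_simp; norm_num
      calc _ = B * (3 * ε₀) ^ r * (N * u ^ r) := by
            rw [hε, ← mul_assoc 3, mul_pow]; ring
        _ ≤ B * (3 * ε₀) * 1 := by gcongr
        _ = 1 / 2 := by rw [mul_one, h2]
    have hsplit : (1 : ENNReal) ≤ P {ω | ∃ t : ℝ,
        DepthNNGP.IsSmallestEigenvalue (A.kernelMatrix v fun i => x i ω) t ∧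
          c₁ * (d : ℝ) ≤ t ∧ t ≤ c₂ * (d : ℝ)} +
        ENNReal.ofReal (N * (2 * Real.exp (-(1 / 24 * (d : ℝ)))) +
        N ^ 2 * Real.exp (-(ε ^ 2 / 3 * (d : ℝ)))) := by
      rw [← measure_univ (μ := P)]
      refine (measure_mono fun ω _ => ?_).trans
        ((measure_union_le _ _).trans (add_le_add le_rfl hbad))
      by_cases hω : (∀ i, η ^ 2 * (d / 2) ≤ ‖x i ω‖ ^ 2 ∧ ‖x i ω‖ ^ 2 ≤ η ^ 2 * (2 * d)) ∧
        ∀ i j, i ≠ j → |inner ℝ (x i ω) (x j ω)| ≤ ε * (η ^ 2 * d)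
      · exact Or.inl (hmain d N (by exact_mod_cast (by linarith : (1 : ℝ) ≤ d)) hN
          (fun i => x i ω) ε hω.1 hω.2 hεd hNε)
      · exact Or.inr hω
    have hreal := ENNReal.toReal_mono (by finiteness) hsplit
    rw [ENNReal.toReal_add (by finiteness) (by finiteness), ENNReal.toReal_one,
      ENNReal.toReal_ofReal (by positivity)] at hreal
    have hexp : 2 * Real.exp (-(1 / 24 * (d : ℝ))) ≤ Real.exp (-(1 / 48 * (d : ℝ))) := by
      have h1 : (2 : ℝ) ≤ Real.exp (1 / 48 * d) := by
        have := Real.add_one_le_exp (1 / 48 * (d : ℝ))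
        linarith
      calc _ ≤ Real.exp (1 / 48 * d) * Real.exp (-(1 / 24 * (d : ℝ))) := by gcongr
        _ = _ := by rw [← Real.exp_add]; congr 1; ring
    have heq : ε ^ 2 / 3 * (d : ℝ) = ε₀ ^ 2 / 3 * (d * u ^ 2) := by rw [hε]; ring
    rw [heq] at hreal
    have hfin := mul_le_mul_of_nonneg_left hexp (by linarith : (0 : ℝ) ≤ N)
    rw [measureReal_def]
    linarith
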